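/- **Setting.** Let $\sigma,\mu>0$ and let $G\subset\mathbb R^2=\partial\mathbb R^3_+$ be open. For real functions $u$ on $\mathbb R\times\mathbb R^2$ with $e^{-\sigma t}u\in L^2$, supported in $[0,\infty)\times\overline G$, put $\hat u(\omega,\xi)=\iint e^{i\omega t-i\xi\cdot x}u(t,x)\,dx\,dt$ for $\omega=\xi_0+i\sigma$ (understood in the $L^2$ sense), $$\|u\|_{s,r,\sigma,*}^2=(2\pi)^{-3}\int_{\mathbb R^3}|\omega|^{2s}(|\omega|^2+|\xi|^2)^r|\hat u(\omega,\xi)|^2\,d\xi_0\,d\xi ,\qquad \langle u,v\rangle_\sigma=\int_0^\infty e^{-2\sigma t}\int_G u v\,dx\,dt,\quad \|u\|_{0,0,\sigma}^2=\langle u,u\rangle_\sigma .$$ Let $H^0_\sigma(\mathbb R^+,\tilde H^{1/2}(G))$ be the space of such $u$ with $\|u\|_{0,\frac12,\sigma,*}<\infty$. The Dirichlet-to-Neumann operator $\mathcal S_\sigma$ of the wave equation $\partial_t^2w=\Delta w$ in the half-space $\mathbb R^3_+$ is defined by $\widehat{\mathcal S_\sigma u}=-i\mu\,\Gamma\,\hat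 u$, where $\Gamma(\omega,\xi)=\sqrt{\omega^2-|\xi|^2}$ with $\operatorname{Im}\Gamma>0$; the duality pairing is $\langle f,v\rangle_\sigma=(2\pi)^{-3}\int\hat f\,\overline{\hat v}\,d\xi_0\,d\xi$. A coercivity constant of $\mathcal S_\sigma$ is a number $C_\sigma>0$ with $$C_\sigma\|\phi\|^2_{-\frac12,\frac12,\sigma,*}\le\operatorname{Re}\langle\mathcal S_\sigma\phi,\phi\rangle_\sigma\qquad\text{for all }\phi\in H^0_\sigma(\mathbb R^+,\tilde H^{1/2}(G)).$$ Let two space-time meshes (for the displacement and the multiplier) be given. Each consists of a finite decomposition of $\overline G$ into nondegenerate closed triangles $S_j$ with pairwise disjoint interiors, $\operatorname{int}S_j\subset G$, a time step $\Delta t>0$ and a number $N\geq 0$ of steps. Let $\tilde V$ be the span of the functions $\beta^m(t)\xi(x)$, $1\le m\le N_1$, where $\beta^m$ is the piecewise linear hat function with node $m\Delta t_1$ and $\xi$ is continuous, affine on each triangle of the first mesh, and zero outside $G$. Let $V^{0,0}$ be the space of functions that are constant on each space-time element $Q_i=[t_{n-1},t_n)\times \operatorname{int}S_j$ ($1\le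 n\le N_2$) of the second mesh and zero elsewhere, and let $K\subset V^{0,0}$ be the cone of nonnegative functions. Let $h\in H^{3/2}_\sigma(\mathbb R^+,H^{-1/2}(G))$ be real, i.e. the restriction to $\mathbb R^+\times G$ of a real distribution on $\mathbb R\times\mathbb R^2$ with $(2\pi)^{-3}\int|\omega|^3(|\omega|^2+|\xi|^2)^{-1/2}|\hat h|^2\,d\xi_0\,d\xi<\infty$, acting on $v\in\tilde V$ by $\langle h,v\rangle_\sigma$. The discrete mixed problem is: find $(u,\lambda)\in\tilde V\times K$ with $$\langle\mathcal S_\sigma u,v\rangle_\sigma-\langle\lambda,v\rangle_\sigma=\langle h,v\rangle_\sigma\quad\forall v\in\tilde V,\qquad\langle u,\mu'-\lambda\rangle_\sigma\ge0\quad\forall \mu'\in K .$$ The space-time Uzawa algorithm with step size $\rho>0$ starts with $\lambda^{(0)}=0$; for $k\ge0$ it determines $u^{(k)}\in\tilde V$ from $\langle\mathcal S_\sigma u^{(k)},v\rangle_\sigma=\langle h+\lambda^{(k)},v\rangle_\sigma$ for all $v\in\tilde V$, and sets $\lambda^{(k+1)}=\operatorname{Pr}_K(\lambda^{(k)}-\rho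 u^{(k)})$; that is, the value of $\lambda^{(k+1)}$ on the element $Q_i$ is $\max\{y_i^{(k)}-\rho x_i^{(k)},0\}$, where $y_i^{(k)}$ is the value of $\lambda^{(k)}$ on $Q_i$ and $x_i^{(k)}=\int_{Q_i}e^{-2\sigma t}u^{(k)}\,/\int_{Q_i}e^{-2\sigma t}$ is the value on $Q_i$ of the $\langle\cdot,\cdot\rangle_\sigma$-orthogonal projection of $u^{(k)}$ to $V^{0,0}$. **Lemma 8.1 (space-time Uzawa convergence).** A coercivity constant exists. If $C_\sigma$ is any coercivity constant and $0<\rho<2C_\sigma$, then the space-time Uzawa algorithm is well defined (the iterates exist and are unique) and converges: there is a solution $(u,\lambda)$ of the discrete mixed problem with $\|u^{(k)}-u\|_{0,0,\sigma}\to0$ and $\|\lambda^{(k)}-\lambda\|_{0,0,\sigma}\to0$ as $k\to\infty$. Moreover, for every solution $(u,\lambda)$ of the discrete mixed problem, the multiplier errors $\|\lambda^{(k)}-\lambda\|_{0,0,\sigma}$ are nonincreasing in $k$, and $\|u^{(k)}-u\|_{0,0,\sigma}\to0$. -/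

import Mathlib

/-! The contact problem for the wave equation (unit speed) on the half-space `x₃ > 0`, in terms of the
Dirichlet-to-Neumann operator on the boundary plane, its mixed Galerkin discretization in
space-time, and the space-time Uzawa iteration. -/

open Filter Topology MeasureTheory FourierTransform
open scoped ENNReal ComplexConjugate

namespace UzawaContact

noncomputable section

/-- The boundary of the half-space. -/
abbrev Plane : Type := EuclideanSpace ℝ (Fin 2)

/-- Points `z = (t, x₁, x₂)` of `ℝ × ℝ²`. -/
abbrev SpaceTime : Type := EuclideanSpace ℝ (Fin 3)

/-- The time coordinate. -/
def time (z : SpaceTime) : ℝ := z 0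

/-- The space coordinates. -/
def pos (z : SpaceTime) : Plane := !₂[z 1, z 2]

/-! ### The Laplace-Fourier transform and the anisotropic Sobolev norms -/

/-- `e^{-σ t} u(t, x)`, complex valued. -/
def damped (σ : ℝ) (u : SpaceTime → ℝ) (z : SpaceTime) : ℂ :=
  ((Real.exp (-σ * time z) * u z : ℝ) : ℂ)

/-- The complex frequency `ω = ξ₀ + i σ`, where `ξ₀ = -2π η₀`. -/
def omega (σ : ℝ) (η : SpaceTime) : ℂ :=
  ((-(2 * Real.pi) * time η : ℝ) : ℂ) + (σ : ℂ) * Complex.I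

/-- The square `|ξ'|²` of the length of the spatial frequency `ξ' = 2π η'`. -/
def xiSq (η : SpaceTime) : ℝ := (2 * Real.pi * ‖pos η‖) ^ 2

open Classical in
/-- The Laplace-Fourier transform `û(ω, ξ') = ∫∫ e^{iωt - iξ'·x} u(t,x) dx dt` at `ω = ξ₀ + iσ`: the
`L²` Fourier transform of `e^{-σt} u`. Here `(ξ₀, ξ') = (-2πη₀, 2πη')`; integration over `η` is
integration over `(ξ₀, ξ')` with the factor `(2π)⁻³`, so that the Plancherel formula holds with
constant `1`. (Set to `0` if `e^{-σt} u` is not square integrable.) -/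
def lapFourier (σ : ℝ) (u : SpaceTime → ℝ) : SpaceTime → ℂ :=
  if hu : MemLp (damped σ u) 2 (volume : Measure SpaceTime) then
    ((𝓕 (hu.toLp (damped σ u)) : Lp ℂ 2 (volume : Measure SpaceTime)) : SpaceTime → ℂ)
  else 0

/-- The weight `|ω|^{2s} (|ω|² + |ξ'|²)^r`. -/
def weight (σ s r : ℝ) (η : SpaceTime) : ℝ :=
  ‖omega σ η‖ ^ (2 * s) * (‖omega σ η‖ ^ 2 + xiSq η) ^ r

/-- The norm `‖u‖_{s,r,σ,*}` of `H^s_σ(ℝ⁺, H̃^r(G))`: the norm over the whole plane of the extension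
of `u` by zero. -/
def sobolevNorm (σ s r : ℝ) (u : SpaceTime → ℝ) : ℝ :=
  Real.sqrt (∫ η : SpaceTime, weight σ s r η * ‖lapFourier σ u η‖ ^ 2)

/-- Membership of a real function in `H^0_σ(ℝ⁺, H̃^{1/2}(G))`: `u` is supported in `[0,∞) × closure G`
and its norm is finite. -/
structure MemTraceSpace (σ : ℝ) (G : Set Plane) (u : SpaceTime → ℝ) : Prop where
  memLp : MemLp (damped σ u) 2 (volume : Measure SpaceTime)
  support : ∀ᵐ z : SpaceTime, ¬ (0 ≤ time z ∧ pos z ∈ closure G) → u z = 0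
  finite : Integrable (fun η : SpaceTime => weight σ 0 (1 / 2) η * ‖lapFourier σ u η‖ ^ 2)

/-- `g` is the Laplace-Fourier transform of an element of `H^{3/2}_σ(H^{-1/2}(ℝ²))`. The
restrictions of these elements to `ℝ⁺ × G` include all of `H^{3/2}_σ(ℝ⁺, H^{-1/2}(G))`. -/
structure IsForceTransform (σ : ℝ) (g : SpaceTime → ℂ) : Prop where
  measurable : AEStronglyMeasurable g (volume : Measure SpaceTime)
  finite : Integrable (fun η : SpaceTime => weight σ (3 / 2) (-(1 / 2)) η * ‖g η‖ ^ 2)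

/-- The duality pairing `⟨f, v⟩_σ = ∫∫ e^{-2σt} f v̄ dx dt`, where `f` is given by its Laplace-Fourier
transform `g`. -/
def pairing (σ : ℝ) (g : SpaceTime → ℂ) (v : SpaceTime → ℝ) : ℂ :=
  ∫ η : SpaceTime, g η * conj (lapFourier σ v η)

/-- The scalar product `⟨u, v⟩_σ = ∫_0^∞ e^{-2σt} ∫_G u v dx dt` of functions that vanish for `t < 0`
and for `x` outside `G`. -/
def innerS (σ : ℝ) (u v : SpaceTime → ℝ) : ℝ :=
  ∫ z : SpaceTime, Real.exp (-2 * σ * time z) * (u z * v z)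

/-- The weighted `L²` norm `‖u‖_{0,0,σ}`. -/
def normS (σ : ℝ) (u : SpaceTime → ℝ) : ℝ := Real.sqrt (innerS σ u u)

/-! ### The Dirichlet-to-Neumann operator of the half-space -/

/-- `Γ(ω, ξ') = √(ω² - |ξ'|²)`, with the branch of positive imaginary part. -/
def rootSymbol (σ : ℝ) (η : SpaceTime) : ℂ :=
  Complex.I * (((xiSq η : ℝ) : ℂ) - omega σ η ^ 2) ^ (1 / 2 : ℂ)

/-- The Laplace-Fourier transform of `𝒮_σ u = -μ ∂w/∂ν`, where `w` is the decaying solution of the wave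
equation in the half-space with trace `u`: since `ŵ(ω, ξ', x₃) = û(ω, ξ') e^{iΓ x₃}`, this is
`-iμΓ û`. -/
def dtnTransform (σ μ : ℝ) (u : SpaceTime → ℝ) (η : SpaceTime) : ℂ :=
  -Complex.I * (μ : ℂ) * rootSymbol σ η * lapFourier σ u η

/-- `C` is a coercivity constant of the Dirichlet-to-Neumann operator:
`C ‖φ‖²_{-1/2,1/2,σ,*} ≤ Re ⟨𝒮_σ φ, φ⟩_σ`. -/
def IsCoercivityConstant (σ μ : ℝ) (G : Set Plane) (C : ℝ) : Prop :=
  0 < C ∧ ∀ φ : SpaceTime → ℝ, MemTraceSpace σ G φ →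
    C * sobolevNorm σ (-(1 / 2)) (1 / 2) φ ^ 2 ≤ (pairing σ (dtnTransform σ μ φ) φ).re

/-! ### Discretization -/

/-- A finite decomposition of (the closure of) `G` into closed nondegenerate triangles with disjoint
interiors, compatible with `G`. Conforming (face-to-face) triangulations are the standard
case, but conformity is not needed. -/
structure Triangulation (G : Set Plane) where
  card : ℕ
  vertex : Fin card → Fin 3 → Plane
  nondegenerate : ∀ j, AffineIndependent ℝ (vertex j)
  disjoint : Pairwise fun i j =>
    Disjoint (interior (convexHull ℝ (Set.range (vertex i))))
      (interior (convexHull ℝ (Set.range (vertex j))))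
  cover : ⋃ j, convexHull ℝ (Set.range (vertex j)) = closure G
  compatible : ∀ j, interior (convexHull ℝ (Set.range (vertex j))) ⊆ G

/-- The `j`-th triangle. -/
def Triangulation.triangle {G : Set Plane} (T : Triangulation G) (j : Fin T.card) : Set Plane :=
  convexHull ℝ (Set.range (T.vertex j))

/-- A space-time mesh: a triangulation in space, a uniform step in time. -/
structure Mesh (G : Set Plane) where
  tri : Triangulation G
  dt : ℝ
  dt_pos : 0 < dt
  steps : ℕ

/-- The space `Ṽ_h^1(G)`: continuous functions, affine on each triangle, that vanish on the boundary
of the open set `G` (and are extended by zero outside `G`). -/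
def spaceP1 {G : Set Plane} (T : Triangulation G) : Submodule ℝ (Plane → ℝ) where
  carrier := {ξ | Continuous ξ ∧ (∀ x, x ∉ G → ξ x = 0) ∧
    ∀ j, ∃ a : Plane →ᵃ[ℝ] ℝ, ∀ x ∈ T.triangle j, ξ x = a x}
  zero_mem' := ⟨continuous_const, fun _ _ => rfl, fun _ => ⟨0, fun _ _ => rfl⟩⟩
  add_mem' := by
    rintro ξ ζ ⟨h1, h2, h3⟩ ⟨k1, k2, k3⟩
    refine ⟨h1.add k1, fun x hx => by simp [h2 x hx, k2 x hx], fun j => ?_⟩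
    obtain ⟨a, ha⟩ := h3 j
    obtain ⟨b, hb⟩ := k3 j
    exact ⟨a + b, fun x hx => by simp [ha x hx, hb x hx]⟩
  smul_mem' := by
    rintro c ξ ⟨h1, h2, h3⟩
    refine ⟨h1.const_smul c, fun x hx => by simp [h2 x hx], fun j => ?_⟩
    obtain ⟨a, ha⟩ := h3 j
    exact ⟨c • a, fun x hx => by simp [ha x hx]⟩

/-- The piecewise linear hat function in time with node `(m+1) Δt`. -/
def hat (dt : ℝ) (m : ℕ) (t : ℝ) : ℝ := max 0 (1 - |t / dt - (m + 1)|)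

/-- The space `Ṽ_{t,h}^{1,1} = V_t^1 ⊗ Ṽ_h^1`, where `V_t^1` is spanned by the hat functions with nodes
`Δt, …, N Δt` (continuous, vanishing at `t = 0`). -/
def dispSpace {G : Set Plane} (M : Mesh G) : Submodule ℝ (SpaceTime → ℝ) :=
  Submodule.span ℝ {u | ∃ m : Fin M.steps, ∃ ξ ∈ spaceP1 M.tri,
    u = fun z => hat M.dt m (time z) * ξ (pos z)}

/-- The index set of the space-time elements. -/
abbrev Mesh.Index {G : Set Plane} (M : Mesh G) : Type := Fin M.steps × Fin M.tri.card

/-- The space-time element `[n Δt, (n+1) Δt) × int S_j`. -/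
def Mesh.cell {G : Set Plane} (M : Mesh G) (i : M.Index) : Set SpaceTime :=
  {z | (i.1 : ℝ) * M.dt ≤ time z ∧ time z < ((i.1 : ℝ) + 1) * M.dt ∧
    pos z ∈ interior (M.tri.triangle i.2)}

/-- The element of `V_{t,h}^{0,0}` (piecewise constant functions in space and time) with coefficient
vector `y`. It is nonnegative if and only if `0 ≤ y`. -/
def pwConst {G : Set Plane} (M : Mesh G) (y : M.Index → ℝ) (z : SpaceTime) : ℝ :=
  ∑ i : M.Index, y i * (M.cell i).indicator 1 z

/-- The coefficient vector of the `⟨·,·⟩_σ`-orthogonal projection of `u` to `V_{t,h}^{0,0}`: the weighted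
means of `u` over the space-time elements. -/
def coeff {G : Set Plane} (M : Mesh G) (σ : ℝ) (u : SpaceTime → ℝ) (i : M.Index) : ℝ :=
  (∫ z in M.cell i, Real.exp (-2 * σ * time z) * u z) /
    ∫ z in M.cell i, Real.exp (-2 * σ * time z)

/-- The discrete equation `⟨𝒮_σ u, v⟩_σ = ⟨h, v⟩_σ + ⟨λ, v⟩_σ` for all `v` in the displacement space, where
`g` is the Laplace-Fourier transform of `h`. (The real parts are those of real quantities when
`h` is real.) -/
def SolvesDtN {G : Set Plane} (M₁ : Mesh G) (σ μ : ℝ) (g : SpaceTime → ℂ)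
    (lam : SpaceTime → ℝ) (u : SpaceTime → ℝ) : Prop :=
  u ∈ dispSpace M₁ ∧ ∀ v ∈ dispSpace M₁,
    (pairing σ (dtnTransform σ μ u) v).re = (pairing σ g v).re + innerS σ lam v

/-- `(u, λ)`, with `λ` given by its coefficient vector `y`, solves the discrete mixed formulation. -/
structure IsMixedSolution {G : Set Plane} (M₁ M₂ : Mesh G) (σ μ : ℝ) (g : SpaceTime → ℂ)
    (u : SpaceTime → ℝ) (y : M₂.Index → ℝ) : Prop where
  nonneg : 0 ≤ y
  equation : SolvesDtN M₁ σ μ g (pwConst M₂ y) u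
  inequality : ∀ m : M₂.Index → ℝ, 0 ≤ m →
    0 ≤ innerS σ u (fun z => pwConst M₂ m z - pwConst M₂ y z)

/-- The iterates `u^{(k)}`, `λ^{(k)}` (with coefficient vectors `y^{(k)}`) of the space-time Uzawa
algorithm: `y^{(0)} = 0`; `u^{(k)}` solves `𝒮 u^{(k)} = h + λ^{(k)}`; with `x^{(k)}` the coefficient
vector of `u^{(k)}` in the multiplier space, `y^{(k+1)} = max {y^{(k)} - ρ x^{(k)}, 0}`. -/
structure IsUzawa {G : Set Plane} (M₁ M₂ : Mesh G) (σ μ ρ : ℝ) (g : SpaceTime → ℂ)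
    (u : ℕ → SpaceTime → ℝ) (y : ℕ → M₂.Index → ℝ) : Prop where
  start : y 0 = 0
  solve : ∀ k, SolvesDtN M₁ σ μ g (pwConst M₂ (y k)) (u k)
  update : ∀ k i, y (k + 1) i = max (y k i - ρ * coeff M₂ σ (u k) i) 0

end

end UzawaContact

open UzawaContact

namespace UzawaContact
-- On the Fourier side the Dirichlet-to-Neumann operator is multiplication by `-iμΓ`, and an
-- elementary computation with the complex square root gives `Re(-iΓ) ≥ σ |ω|⁻¹ (|ω|² + |ξ|²)^{1/2}`
-- (`le_re_symbol`). Hence `μσ` is a coercivity constant. Since the weight `|ω|⁻¹ (|ω|² +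
-- |ξ|²)^{1/2}` is at least `1`, Plancherel turns any coercivity constant `C` into coercivity with
-- the same `C` in the norm `‖·‖_{0,0,σ}` (`FiniteTraceNorm.innerS_le`). The discrete displacements
-- are admissible because, after damping, they are Lipschitz with compact support and so have a
-- square integrable gradient. They form a finite-dimensional space, so the rest is
-- finite-dimensional and is done for an abstract `MixedData`.
--
-- The heart is a Fejér estimate (`MixedData.IsSolution.sqNorm_step_le`). A solution `λ` is a fixed
-- point of the projected update, the projection is nonexpansive, `C‖u_k - u‖² ≤ ⟨λ_k - λ, u_k -
-- u⟩`, and Bessel's inequality bounds the cell means of `u_k - u`. Together they give `‖λ_{k+1} -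
-- λ‖² + ρ(2C - ρ)‖u_k - u‖² ≤ ‖λ_k - λ‖²`. So the multiplier errors decrease and `u_k → u`.
--
-- Multipliers need not be unique, as no inf-sup condition links the two meshes. The bounded
-- sequence `λ_k` has a cluster point; it acts on displacements as a solution's multiplier does,
-- hence is itself a multiplier. Its own Fejér distance is monotone and tends to zero along a
-- subsequence, hence altogether.
--
-- Existence of a solution: the displacements with nonnegative cell means form a closed convex cone.
-- The form need not be symmetric, so the variational inequality on this cone is solved by a
-- contraction, and Farkas' lemma produces the multiplier.
/-! ### Farkas' lemma and variational inequalities in finite dimension -/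

/-- **Farkas' lemma** for finitely many linear functionals. -/
theorem farkas {V ι : Type*} [AddCommGroup V] [Module ℝ V] (s : Finset ι) :
    ∀ (f : ι → V →ₗ[ℝ] ℝ) (γ : V →ₗ[ℝ] ℝ), (∀ x, (∀ i ∈ s, 0 ≤ f i x) → 0 ≤ γ x) →
      ∃ c : ι → ℝ, (∀ i, 0 ≤ c i) ∧ ∀ x, γ x = ∑ i ∈ s, c i * f i x := by
  classical
  induction s using Finset.induction_on with
  | empty =>
    intro f γ h
    refine ⟨0, fun _ => le_rfl, fun x => ?_⟩
    have h1 := h x (by simp)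
    have h2 := h (-x) (by simp)
    rw [map_neg] at h2
    simp only [Finset.sum_empty]
    linarith
  | insert j s hj ih =>
    intro f γ h
    by_cases hs : ∀ x, (∀ i ∈ s, 0 ≤ f i x) → 0 ≤ γ x
    · obtain ⟨c, hc, hγ⟩ := ih f γ hs
      refine ⟨fun i => if i = j then 0 else c i, fun i => ?_, fun x => ?_⟩
      · dsimp only
        split_ifs
        exacts [le_rfl, hc i]
      · rw [Finset.sum_insert hj, hγ x]
        simp only [if_true, zero_mul, zero_add]
        refine Finset.sum_congr rfl fun i hi => ?_
        rw [if_neg (ne_of_mem_of_not_mem hi hj)]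
    · push Not at hs
      obtain ⟨z, hz, hγz⟩ := hs
      have hjz : f j z < 0 := by
        by_contra! hcon
        refine absurd (h z fun i hi => ?_) (not_le.2 hγz)
        rcases Finset.mem_insert.1 hi with rfl | hi
        exacts [hcon, hz i hi]
      -- `P` projects along `z` onto the kernel of `f j`. There the constraint `j` holds trivially,
      -- so the induction hypothesis applies to the functionals composed with `P`.
      let P : V →ₗ[ℝ] V := LinearMap.id - (((f j z)⁻¹ • f j).smulRight z)
      have hP : ∀ x, P x = x - ((f j z)⁻¹ * f j x) • z := fun x => by simp [P]
      obtain ⟨c, hc, hγ⟩ := ih (fun i => f i ∘ₗ P) (γ ∘ₗ P) (fun x hx => by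
        refine h (P x) fun i hi => ?_
        rcases Finset.mem_insert.1 hi with rfl | hi
        · rw [hP, map_sub, map_smul, smul_eq_mul, mul_right_comm, inv_mul_cancel₀ hjz.ne]
          simp
        · exact hx i hi)
      have hsum : 0 ≤ ∑ i ∈ s, c i * f i z :=
        Finset.sum_nonneg fun i hi => mul_nonneg (hc i) (hz i hi)
      -- The coefficient of `f j` is forced by evaluating the identity at `z`. It is nonnegative
      -- because `f j z < 0`, `γ z < 0` and the sum at `z` is nonnegative.
      refine ⟨fun i => if i = j then (f j z)⁻¹ * (γ z - ∑ i ∈ s, c i * f i z) else c i,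
        fun i => ?_, fun x => ?_⟩
      · dsimp only
        split_ifs
        · exact mul_nonneg_of_nonpos_of_nonpos (inv_nonpos.2 hjz.le) (by linarith)
        · exact hc i
      · have hx := hγ x
        simp only [LinearMap.comp_apply, hP, map_sub, map_smul, smul_eq_mul, mul_sub,
          Finset.sum_sub_distrib] at hx
        have e : ∑ i ∈ s, c i * ((f j z)⁻¹ * f j x * f i z)
            = (f j z)⁻¹ * f j x * ∑ i ∈ s, c i * f i z := by
          rw [Finset.mul_sum]
          exact Finset.sum_congr rfl fun i _ => by ring
        rw [e] at hx
        rw [Finset.sum_insert hj]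
        dsimp only
        rw [if_pos rfl]
        have e2 : ∑ i ∈ s, (if i = j then (f j z)⁻¹ * (γ z - ∑ i ∈ s, c i * f i z) else c i)
            * f i x = ∑ i ∈ s, c i * f i x :=
          Finset.sum_congr rfl fun i hi => by rw [if_neg (ne_of_mem_of_not_mem hi hj)]
        rw [e2]
        linear_combination hx

section VI

variable {E : Type*} [NormedAddCommGroup E] [InnerProductSpace ℝ E]

open scoped InnerProductSpace

/-- The metric projection onto a closed convex set is nonexpansive. -/
theorem norm_sub_le_of_inner_le_zero {u₁ u₂ p₁ p₂ : E}
    (h₁ : ⟪u₁ - p₁, p₂ - p₁⟫_ℝ ≤ 0) (h₂ : ⟪u₂ - p₂, p₁ - p₂⟫_ℝ ≤ 0) :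
    ‖p₁ - p₂‖ ≤ ‖u₁ - u₂‖ := by
  have e1 : ⟪u₁ - p₁, p₂ - p₁⟫_ℝ = -⟪u₁ - p₁, p₁ - p₂⟫_ℝ := by
    rw [← inner_neg_right, neg_sub]
  have e2 : ⟪u₁ - u₂, p₁ - p₂⟫_ℝ = ⟪u₁ - p₁, p₁ - p₂⟫_ℝ + ⟪p₁ - p₂, p₁ - p₂⟫_ℝ
      - ⟪u₂ - p₂, p₁ - p₂⟫_ℝ := by
    rw [← inner_add_left, ← inner_sub_left]
    congr 1
    abel
  have e3 := real_inner_le_norm (u₁ - u₂) (p₁ - p₂)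
  rw [real_inner_self_eq_norm_sq] at e2
  rcases (norm_nonneg (p₁ - p₂)).eq_or_lt with h0 | h0
  · rw [← h0]; exact norm_nonneg _
  · refine le_of_mul_le_mul_right ?_ h0
    nlinarith

/-- A strongly monotone Lipschitz variational inequality has a solution. -/
theorem exists_variational_inequality [CompleteSpace E] {K : Set E} (hne : K.Nonempty)
    (hcl : IsClosed K) (hcv : Convex ℝ K) (B : E → E) {C L : ℝ} (hC : 0 < C)
    (hmono : ∀ u v, C * ‖u - v‖ ^ 2 ≤ ⟪B u - B v, u - v⟫_ℝ)
    (hlip : ∀ u v, ‖B u - B v‖ ≤ L * ‖u - v‖) :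
    ∃ u ∈ K, ∀ v ∈ K, 0 ≤ ⟪B u, v - u⟫_ℝ := by
  -- Enlarging `L` makes the squared contraction factor `1 - C²/L²` nonnegative.
  wlog hL : C ≤ L generalizing L
  · exact this (L := max C L) (fun u v => (hlip u v).trans
      (mul_le_mul_of_nonneg_right (le_max_right _ _) (norm_nonneg _))) (le_max_left _ _)
  have hL0 : 0 < L := hC.trans_le hL
  have hproj : ∀ u : E, ∃ p ∈ K, ∀ w ∈ K, ⟪u - p, w - p⟫_ℝ ≤ 0 := fun u => by
    obtain ⟨p, hp, h⟩ := exists_norm_eq_iInf_of_complete_convex hne hcl.isComplete hcv u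
    exact ⟨p, hp, (norm_eq_iInf_iff_real_inner_le_zero hcv hp).1 h⟩
  choose p hpK hp using hproj
  -- This `τ` minimizes `1 - 2τC + τ²L²`, which bounds the squared Lipschitz factor of the projected
  -- step `u ↦ p (u - τ B u)`; the minimum is `q` below.
  set τ := C / L ^ 2 with hτ
  have hτ0 : 0 < τ := by positivity
  let T : E → E := fun u => p (u - τ • B u)
  set q := 1 - C ^ 2 / L ^ 2 with hq
  have hq0 : 0 ≤ q := by
    rw [hq, sub_nonneg, div_le_one (by positivity)]
    exact pow_le_pow_left₀ hC.le hL 2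
  have hq1 : q < 1 := by
    have : 0 < C ^ 2 / L ^ 2 := by positivity
    linarith
  have hT : ∀ u v, ‖T u - T v‖ ≤ Real.sqrt q * ‖u - v‖ := fun u v => by
    refine (norm_sub_le_of_inner_le_zero (hp _ _ (hpK _)) (hp _ _ (hpK _))).trans ?_
    refine abs_le_of_sq_le_sq' ?_ (by positivity) |>.2
    have e : u - τ • B u - (v - τ • B v) = (u - v) - τ • (B u - B v) := by
      rw [smul_sub]; abel
    rw [e, norm_sub_sq_real, inner_smul_right, norm_smul, mul_pow, mul_pow, Real.sq_sqrt hq0,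
      real_inner_comm]
    have h1 := hmono u v
    have h2 : ‖B u - B v‖ ^ 2 ≤ L ^ 2 * ‖u - v‖ ^ 2 := by
      rw [← mul_pow]
      exact pow_le_pow_left₀ (norm_nonneg _) (hlip u v) 2
    have h3 : ‖τ‖ ^ 2 * ‖B u - B v‖ ^ 2 ≤ τ ^ 2 * (L ^ 2 * ‖u - v‖ ^ 2) := by
      rw [Real.norm_eq_abs, sq_abs]
      exact mul_le_mul_of_nonneg_left h2 (sq_nonneg _)
    have h4 : τ * (C * ‖u - v‖ ^ 2) ≤ τ * ⟪B u - B v, u - v⟫_ℝ :=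
      mul_le_mul_of_nonneg_left h1 hτ0.le
    have h5 : τ ^ 2 * (L ^ 2 * ‖u - v‖ ^ 2) = C ^ 2 / L ^ 2 * ‖u - v‖ ^ 2 := by
      rw [hτ]; field_simp
    have h6 : τ * (C * ‖u - v‖ ^ 2) = C ^ 2 / L ^ 2 * ‖u - v‖ ^ 2 := by
      rw [hτ]; field_simp
    rw [hq]
    nlinarith
  have hcontr : ContractingWith (Real.sqrt q).toNNReal T := by
    refine ⟨?_, LipschitzWith.of_dist_le_mul fun u v => ?_⟩
    · rw [← NNReal.coe_lt_coe, Real.coe_toNNReal _ (Real.sqrt_nonneg _), NNReal.coe_one,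
        Real.sqrt_lt' one_pos]
      simpa using hq1
    · rw [dist_eq_norm, dist_eq_norm, Real.coe_toNNReal _ (Real.sqrt_nonneg _)]
      exact hT u v
  obtain ⟨u, hu⟩ : ∃ u, T u = u := by
    obtain ⟨u, hu, -⟩ := hcontr.exists_fixedPoint 0 (edist_ne_top _ _)
    exact ⟨u, hu⟩
  refine ⟨u, hu ▸ hpK _, fun v hv => ?_⟩
  have h := hp (u - τ • B u) v hv
  have hu' : p (u - τ • B u) = u := hu
  rw [hu', sub_sub_cancel_left, inner_neg_left, inner_smul_left] at h
  simp only [conj_trivial, neg_nonpos] at h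
  exact nonneg_of_mul_nonneg_right h hτ0

end VI

/-! ### The Uzawa iteration in a finite-dimensional space -/

/-- The data of a discrete mixed problem: a coercive bilinear form `a`, a load `ℓ`, and a map `x` to
coefficient vectors that satisfies Bessel's inequality with respect to the weights `w`. -/
structure MixedData (E ι : Type*) [NormedAddCommGroup E] [InnerProductSpace ℝ E] [Fintype ι] where
  a : E →ₗ[ℝ] E →ₗ[ℝ] ℝ
  ℓ : E →ₗ[ℝ] ℝ
  x : E →ₗ[ℝ] ι → ℝ
  w : ι → ℝ
  C : ℝ
  C_pos : 0 < C
  coercive : ∀ u, C * ‖u‖ ^ 2 ≤ a u u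
  w_pos : ∀ i, 0 < w i
  bessel : ∀ u, ∑ i, w i * x u i ^ 2 ≤ ‖u‖ ^ 2

namespace MixedData

variable {E ι : Type*} [NormedAddCommGroup E] [InnerProductSpace ℝ E] [Fintype ι]
  (D : MixedData E ι)

/-- The pairing of a coefficient vector with an element of `E`. -/
def pair (y : ι → ℝ) (v : E) : ℝ := ∑ i, D.w i * y i * D.x v i

/-- The weighted sum of squares of a coefficient vector. -/
def sqNorm (y : ι → ℝ) : ℝ := ∑ i, D.w i * y i ^ 2

/-- `u` solves the linear equation with multiplier `y`. -/
def Solves (y : ι → ℝ) (u : E) : Prop := ∀ v, D.a u v = D.ℓ v + D.pair y v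

/-- `(u, y)` solves the mixed problem. -/
structure IsSolution (u : E) (y : ι → ℝ) : Prop where
  nonneg : 0 ≤ y
  solves : D.Solves y u
  inequality : ∀ m : ι → ℝ, 0 ≤ m → 0 ≤ D.pair (m - y) u

/-- The pairing as a linear functional. -/
def pairLin (y : ι → ℝ) : E →ₗ[ℝ] ℝ where
  toFun := D.pair y
  map_add' u v := by simp [pair, mul_add, Finset.sum_add_distrib]
  map_smul' c v := by
    simp only [pair, map_smul, Pi.smul_apply, smul_eq_mul, RingHom.id_apply, Finset.mul_sum]
    exact Finset.sum_congr rfl fun i _ => by ring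

theorem pair_sub (y z : ι → ℝ) (v : E) : D.pair (y - z) v = D.pair y v - D.pair z v := by
  simp [pair, mul_sub, sub_mul, Finset.sum_sub_distrib]

theorem sqNorm_nonneg (y : ι → ℝ) : 0 ≤ D.sqNorm y :=
  Finset.sum_nonneg fun i _ => mul_nonneg (D.w_pos i).le (sq_nonneg _)

theorem eq_zero_of_form_eq_zero {u : E} (h : ∀ v, D.a u v = 0) : u = 0 := by
  have h1 := D.coercive u
  rw [h u] at h1
  have h2 : ‖u‖ ^ 2 = 0 := le_antisymm
    (nonpos_of_mul_nonpos_right h1 D.C_pos) (sq_nonneg _)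
  simpa using h2

/-- Coercivity makes `u ↦ a u ·` injective, and an injective linear map from a finite-dimensional
space to its dual is onto. -/
theorem existsUnique_solves [FiniteDimensional ℝ E] (y : ι → ℝ) : ∃! u, D.Solves y u := by
  have hinj : Function.Injective D.a := by
    rw [← LinearMap.ker_eq_bot, LinearMap.ker_eq_bot']
    intro u hu
    exact D.eq_zero_of_form_eq_zero fun v => by rw [hu]; rfl
  have hsurj : Function.Surjective D.a :=
    (LinearMap.injective_iff_surjective_of_finrank_eq_finrank
      (Subspace.dual_finrank_eq (K := ℝ) (V := E)).symm).1 hinj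
  obtain ⟨u, hu⟩ := hsurj (D.ℓ + D.pairLin y)
  refine ⟨u, fun v => by rw [hu]; rfl, fun u' hu' => hinj ?_⟩
  rw [hu]
  ext v
  exact hu' v

/-- Existence of a solution of the mixed problem. -/
theorem exists_isSolution [FiniteDimensional ℝ E] : ∃ u y, D.IsSolution u y := by
  have := FiniteDimensional.complete ℝ E
  let A : E →ₗ[ℝ] E :=
    (InnerProductSpace.toDual ℝ E).symm.toLinearEquiv.toLinearMap ∘ₗ
      LinearMap.toContinuousLinearMap.toLinearMap ∘ₗ D.a
  have hA : ∀ u v, inner ℝ (A u) v = D.a u v := fun u v => by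
    simp [A]
  let f : E := (InnerProductSpace.toDual ℝ E).symm (LinearMap.toContinuousLinearMap D.ℓ)
  have hf : ∀ v, inner ℝ f v = D.ℓ v := fun v => by simp [f]
  let Ac : E →L[ℝ] E := LinearMap.toContinuousLinearMap A
  obtain ⟨u, huK, hu⟩ := exists_variational_inequality (E := E) (K := {v | ∀ i, 0 ≤ D.x v i})
    ⟨0, fun i => by simp⟩
    (by
      have hx : Continuous D.x := D.x.continuous_of_finiteDimensional
      have : {v | ∀ i, 0 ≤ D.x v i} = ⋂ i, {v | 0 ≤ D.x v i} := by ext; simp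
      rw [this]
      exact isClosed_iInter fun i =>
        isClosed_le continuous_const ((continuous_apply i).comp hx))
    (by
      intro v hv z hz s t hs ht _ i
      simp only [map_add, map_smul, Pi.add_apply, Pi.smul_apply, smul_eq_mul]
      exact add_nonneg (mul_nonneg hs (hv i)) (mul_nonneg ht (hz i)))
    (fun u => A u - f) (C := D.C) (L := ‖Ac‖) D.C_pos
    (fun u v => by
      rw [sub_sub_sub_cancel_right, ← map_sub, hA]
      exact D.coercive _)
    (fun u v => by
      rw [sub_sub_sub_cancel_right, ← map_sub]
      exact Ac.le_opNorm _)
  have hvi : ∀ v, (∀ i, 0 ≤ D.x v i) → 0 ≤ D.a u (v - u) - D.ℓ (v - u) := fun v hv => by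
    have := hu v hv
    rwa [inner_sub_left, hA, hf] at this
  -- The constraint set is a cone, so both `0` and `2u` may be used as test elements.
  have h0 : D.a u u - D.ℓ u = 0 := by
    have h1 := hvi 0 (fun i => by simp)
    have h2 := hvi (u + u) (fun i => by
      rw [map_add]; exact add_nonneg (huK i) (huK i))
    rw [add_sub_cancel_right] at h2
    rw [zero_sub, map_neg, map_neg] at h1
    linarith
  -- By `hvi` and `h0` the residual `a u - ℓ` is nonnegative on the cone cut out by the cell means,
  -- hence a nonnegative combination of them. Dividing its coefficients by the weights gives the
  -- multiplier.
  obtain ⟨c, hc, hγ⟩ := farkas Finset.univ (fun i => LinearMap.proj i ∘ₗ D.x) (D.a u - D.ℓ)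
    (fun v hv => by
      have := hvi v (fun i => hv i (Finset.mem_univ i))
      rw [map_sub, map_sub] at this
      simp only [LinearMap.sub_apply]
      linarith)
  have hp : ∀ v, D.pair (fun i => c i / D.w i) v = D.a u v - D.ℓ v := fun v => by
    have := hγ v
    rw [LinearMap.sub_apply] at this
    rw [this]
    refine Finset.sum_congr rfl fun i _ => ?_
    rw [mul_div_cancel₀ _ (D.w_pos i).ne']
    rfl
  refine ⟨u, fun i => c i / D.w i, fun i => div_nonneg (hc i) (D.w_pos i).le, fun v => ?_,
    fun m hm => ?_⟩
  · rw [hp]; ring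
  · rw [pair_sub, hp, h0, sub_zero]
    exact Finset.sum_nonneg fun i _ => mul_nonneg (mul_nonneg (D.w_pos i).le (hm i)) (huK i)

/-- A multiplier of the mixed problem is a fixed point of the Uzawa update. -/
theorem IsSolution.max_eq {D : MixedData E ι} {u : E} {y : ι → ℝ} (h : D.IsSolution u y) {ρ : ℝ}
    (hρ : 0 < ρ) (i : ι) : max (y i - ρ * D.x u i) 0 = y i := by
  classical
  -- Changing one component of the multiplier localizes the inequality to a single element. The
  -- choices `s = 1` and `s = -y i` give sign and complementarity.
  have key : ∀ s : ℝ, 0 ≤ y i + s → 0 ≤ s * D.x u i := fun s hs => by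
    have h1 := h.inequality (y + Pi.single i s) (fun j => by
      by_cases hj : j = i
      · subst hj; simpa using hs
      · simpa [hj] using h.nonneg j)
    rw [add_sub_cancel_left, pair, Finset.sum_eq_single i (fun j _ hj => by simp [hj]) (by simp),
      Pi.single_eq_same, mul_assoc] at h1
    exact nonneg_of_mul_nonneg_right h1 (D.w_pos i)
  have hy : 0 ≤ y i := h.nonneg i
  have h1 : 0 ≤ D.x u i := by simpa using key 1 (by linarith)
  have h2 := key (-y i) (by simp)
  have h3 : y i * D.x u i = 0 := le_antisymm (by linarith) (mul_nonneg hy h1)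
  rcases mul_eq_zero.1 h3 with h4 | h4
  · rw [h4]
    exact max_eq_right (by nlinarith)
  · rw [h4, mul_zero, sub_zero, max_eq_left hy]

/-- The Fejér estimate for one Uzawa step. -/
theorem IsSolution.sqNorm_step_le {D : MixedData E ι} {us : E} {ys : ι → ℝ}
    (h : D.IsSolution us ys) {ρ : ℝ} (hρ : 0 < ρ) {u : E} {y y' : ι → ℝ} (hu : D.Solves y u)
    (hy : ∀ i, y' i = max (y i - ρ * D.x u i) 0) :
    D.sqNorm (y' - ys) + ρ * (2 * D.C - ρ) * ‖u - us‖ ^ 2 ≤ D.sqNorm (y - ys) := by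
  -- The load cancels in the difference of the two equations.
  have h1 : D.C * ‖u - us‖ ^ 2 ≤ D.pair (y - ys) (u - us) := by
    have e := D.coercive (u - us)
    have : D.a (u - us) (u - us) = D.pair (y - ys) (u - us) := by
      rw [map_sub D.a, LinearMap.sub_apply, hu, h.solves, pair_sub]
      ring
    rwa [this] at e
  have h2 : D.sqNorm (y' - ys) ≤
      D.sqNorm (y - ys) - 2 * ρ * D.pair (y - ys) (u - us)
        + ρ ^ 2 * ∑ i, D.w i * D.x (u - us) i ^ 2 := by
    simp only [sqNorm, pair, Finset.mul_sum, ← Finset.sum_sub_distrib, ← Finset.sum_add_distrib]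
    refine Finset.sum_le_sum fun i _ => ?_
    have e : (y' i - ys i) ^ 2 ≤ (y i - ys i - ρ * (D.x u i - D.x us i)) ^ 2 := by
      have : |y' i - ys i| ≤ |y i - ys i - ρ * (D.x u i - D.x us i)| := by
        rw [hy i]
        -- With `ys i` written as its own update, both terms are positive parts, and the positive
        -- part is nonexpansive.
        nth_rewrite 1 [← h.max_eq hρ i]
        refine (abs_max_sub_max_le_abs _ _ _).trans (le_of_eq ?_)
        congr 1; ring
      exact sq_le_sq.2 this
    have := mul_le_mul_of_nonneg_left e (D.w_pos i).le
    simp only [Pi.sub_apply, map_sub]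
    refine this.trans (le_of_eq (by ring))
  have h3 := mul_le_mul_of_nonneg_left (D.bessel (u - us)) (sq_nonneg ρ)
  nlinarith [mul_le_mul_of_nonneg_left h1 hρ.le]

/-- Consequences of the Fejér estimate for the whole iteration. -/
theorem IsSolution.antitone_and_tendsto {D : MixedData E ι} {us : E} {ys : ι → ℝ}
    (h : D.IsSolution us ys) {ρ : ℝ} (hρ : 0 < ρ) (hρC : ρ < 2 * D.C) {u : ℕ → E}
    {y : ℕ → ι → ℝ} (hu : ∀ k, D.Solves (y k) (u k))
    (hy : ∀ k i, y (k + 1) i = max (y k i - ρ * D.x (u k) i) 0) :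
    Antitone (fun k => D.sqNorm (y k - ys)) ∧ Tendsto (fun k => ‖u k - us‖) atTop (𝓝 0) := by
  have step := fun k => h.sqNorm_step_le hρ (hu k) (hy k)
  set κ := ρ * (2 * D.C - ρ)
  have hκ : 0 < κ := mul_pos hρ (by linarith)
  have anti : Antitone (fun k => D.sqNorm (y k - ys)) := antitone_nat_of_succ_le fun k => by
    have := step k
    nlinarith [mul_nonneg hκ.le (sq_nonneg ‖u k - us‖)]
  refine ⟨anti, ?_⟩
  -- A nonincreasing sequence bounded below converges, so its successive differences tend to zero;
  -- they dominate `κ ‖u k - us‖²`.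
  obtain ⟨l, hl⟩ : ∃ l, Tendsto (fun k => D.sqNorm (y k - ys)) atTop (𝓝 l) :=
    ⟨_, tendsto_atTop_ciInf anti ⟨0, by rintro _ ⟨k, rfl⟩; exact D.sqNorm_nonneg _⟩⟩
  have hd : Tendsto (fun k => κ⁻¹ * (D.sqNorm (y k - ys) - D.sqNorm (y (k + 1) - ys)))
      atTop (𝓝 0) := by
    have := (hl.sub (hl.comp (tendsto_add_atTop_nat 1))).const_mul κ⁻¹
    simpa using this
  have hsq : Tendsto (fun k => ‖u k - us‖ ^ 2) atTop (𝓝 0) := by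
    refine squeeze_zero (fun k => sq_nonneg _) (fun k => ?_) hd
    rw [← div_eq_inv_mul, le_div_iff₀ hκ]
    linarith [step k]
  have := hsq.sqrt
  simpa [Real.sqrt_sq] using this

/-- Convergence of the Uzawa iteration to some solution of the mixed problem. -/
theorem exists_tendsto [FiniteDimensional ℝ E] {ρ : ℝ} (hρ : 0 < ρ) (hρC : ρ < 2 * D.C) {u : ℕ → E} {y : ℕ → ι → ℝ}
    (hy0 : y 0 = 0) (hu : ∀ k, D.Solves (y k) (u k))
    (hy : ∀ k i, y (k + 1) i = max (y k i - ρ * D.x (u k) i) 0) :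
    ∃ us ys, D.IsSolution us ys ∧ Tendsto (fun k => ‖u k - us‖) atTop (𝓝 0) ∧
      Tendsto (fun k => D.sqNorm (y k - ys)) atTop (𝓝 0) := by
  obtain ⟨us, y₁, hsol⟩ := D.exists_isSolution
  obtain ⟨anti, hlim⟩ := hsol.antitone_and_tendsto hρ hρC hu hy
  have hynn : ∀ k, 0 ≤ y k := fun k => by
    cases k with
    | zero => rw [hy0]
    | succ k => intro i; rw [hy k i]; exact le_max_right _ _
  have hu' : Tendsto u atTop (𝓝 us) := tendsto_iff_norm_sub_tendsto_zero.2 hlim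
  obtain ⟨R, hR⟩ : ∃ R : ℝ, ∀ k, y k ∈ Set.Icc (fun i => y₁ i - R) (fun i => y₁ i + R) := by
    set B := D.sqNorm (y 0 - y₁)
    have hb : ∀ k i, |y k i - y₁ i| ≤ Real.sqrt (B / D.w i) := fun k i => by
      refine Real.abs_le_sqrt ?_
      rw [le_div_iff₀ (D.w_pos i)]
      have h1 := anti (Nat.zero_le k)
      have h2 : D.w i * (y k - y₁) i ^ 2 ≤ D.sqNorm (y k - y₁) :=
        Finset.single_le_sum (f := fun i => D.w i * (y k - y₁) i ^ 2)
          (fun j _ => mul_nonneg (D.w_pos j).le (sq_nonneg _)) (Finset.mem_univ i)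
      simp only [Pi.sub_apply] at h2
      dsimp only at h1
      linarith
    refine ⟨∑ i, Real.sqrt (B / D.w i), fun k => ⟨fun i => ?_, fun i => ?_⟩⟩ <;>
    · have h1 := abs_le.1 (hb k i)
      have h2 : Real.sqrt (B / D.w i) ≤ ∑ i, Real.sqrt (B / D.w i) :=
        Finset.single_le_sum (f := fun i => Real.sqrt (B / D.w i))
          (fun j _ => Real.sqrt_nonneg _) (Finset.mem_univ i)
      dsimp only
      linarith [h1.1, h1.2]
  obtain ⟨ys, -, φ, hφ, hys⟩ := isCompact_Icc.tendsto_subseq hR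
  have hys' : ∀ i, Tendsto (fun k => y (φ k) i) atTop (𝓝 (ys i)) := fun i =>
    ((continuous_apply i).tendsto ys).comp hys
  have hpair : ∀ v, Tendsto (fun k => D.pair (y (φ k)) v) atTop (𝓝 (D.pair ys v)) := fun v =>
    tendsto_finsetSum _ fun i _ => ((hys' i).const_mul _).mul_const _
  -- The cluster point may differ from `y₁`, but passing to the limit in the equation shows that
  -- both act alike on `E`. The equation and the inequality see a multiplier only through this
  -- action, so `ys` is also a solution.
  have hyseq : ∀ v, D.pair ys v = D.pair y₁ v := fun v => by
    have hav : Continuous (fun u => D.a u v) :=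
      (D.a.flip v).continuous_of_finiteDimensional
    have h1 : Tendsto (fun k => D.a (u (φ k)) v) atTop (𝓝 (D.a us v)) :=
      (hav.tendsto us).comp (hu'.comp hφ.tendsto_atTop)
    have h2 : Tendsto (fun k => D.a (u (φ k)) v) atTop (𝓝 (D.ℓ v + D.pair ys v)) := by
      simp only [fun k => hu (φ k) v]
      exact (hpair v).const_add _
    have h3 := tendsto_nhds_unique h1 h2
    rw [hsol.solves v] at h3
    linarith
  have hsol' : D.IsSolution us ys := by
    refine ⟨fun i => ge_of_tendsto' (hys' i) fun k => hynn _ i, fun v => ?_, fun m hm => ?_⟩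
    · rw [hsol.solves v, hyseq]
    · rw [pair_sub, hyseq, ← pair_sub]
      exact hsol.inequality m hm
  -- The Fejér estimate is now applied relative to the cluster point itself: a monotone distance
  -- that is small at one index stays small.
  obtain ⟨anti', -⟩ := hsol'.antitone_and_tendsto hρ hρC hu hy
  refine ⟨us, ys, hsol', hlim, ?_⟩
  have hsub : Tendsto (fun k => D.sqNorm (y (φ k) - ys)) atTop (𝓝 0) := by
    have : Tendsto (fun k => D.sqNorm (y (φ k) - ys)) atTop (𝓝 (∑ i, D.w i * (ys i - ys i) ^ 2)) :=
      tendsto_finsetSum _ fun i _ => (((hys' i).sub_const _).pow 2).const_mul _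
    simpa using this
  rw [Metric.tendsto_atTop] at hsub ⊢
  intro ε hε
  obtain ⟨N, hN⟩ := hsub ε hε
  refine ⟨φ N, fun k hk => ?_⟩
  have h1 := hN N le_rfl
  rw [Real.dist_eq, sub_zero, abs_of_nonneg (D.sqNorm_nonneg _)] at h1 ⊢
  exact (anti' hk).trans_lt h1

section Transport

variable {V : Type*} [AddCommGroup V] [Module ℝ V] (e : V ≃ₗ[ℝ] E)
  (a : V →ₗ[ℝ] V →ₗ[ℝ] ℝ) (ℓ : V →ₗ[ℝ] ℝ) (x : V →ₗ[ℝ] ι → ℝ) (w : ι → ℝ) (C : ℝ) (hC : 0 < C)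
  (ha : ∀ v, C * ‖e v‖ ^ 2 ≤ a v v) (hw : ∀ i, 0 < w i)
  (hx : ∀ v, ∑ i, w i * x v i ^ 2 ≤ ‖e v‖ ^ 2)

/-- Transport of a mixed problem along a linear equivalence. -/
def ofEquiv : MixedData E ι where
  a := a.compl₁₂ e.symm.toLinearMap e.symm.toLinearMap
  ℓ := ℓ ∘ₗ e.symm.toLinearMap
  x := x ∘ₗ e.symm.toLinearMap
  w := w
  C := C
  C_pos := hC
  coercive u := by simpa using ha (e.symm u)
  w_pos := hw
  bessel u := by simpa using hx (e.symm u)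

theorem ofEquiv_a (u v : V) : (ofEquiv e a ℓ x w C hC ha hw hx).a (e u) (e v) = a u v := by
  simp [ofEquiv]

theorem ofEquiv_ℓ (v : V) : (ofEquiv e a ℓ x w C hC ha hw hx).ℓ (e v) = ℓ v := by
  simp [ofEquiv]

theorem ofEquiv_x (v : V) : (ofEquiv e a ℓ x w C hC ha hw hx).x (e v) = x v := by
  simp [ofEquiv]

end Transport

end MixedData
/-! ### Square integrability of the Fourier transform of the gradient of a Lipschitz function -/

section Lipschitz

open scoped NNReal LineDeriv SchwartzMap ContDiff

theorem lineDeriv_eq_zero_of_notMem_tsupport {E : Type*} [NormedAddCommGroup E] [NormedSpace ℝ E] {f : E → ℝ} {x : E} (hx : x ∉ tsupport f) (v : E) :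
    lineDeriv ℝ f x v = 0 := by
  have h : f =ᶠ[𝓝 x] fun _ => 0 := notMem_tsupport_iff_eventuallyEq.1 hx
  rw [h.lineDeriv_eq]
  simp [lineDeriv]

theorem schwartz_lipschitz {E : Type*} [NormedAddCommGroup E] [NormedSpace ℝ E] (ψ : 𝓢(E, ℂ)) : ∃ K : ℝ≥0, LipschitzWith K ψ := by
  obtain ⟨C, hC, h⟩ := ψ.decay 0 1
  refine ⟨C.toNNReal, lipschitzWith_of_nnnorm_fderiv_le ψ.differentiable fun x => ?_⟩
  rw [← NNReal.coe_le_coe, Real.coe_toNNReal _ hC.le, coe_nnnorm]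
  simpa [norm_iteratedFDeriv_one] using h x

variable {E : Type*} [NormedAddCommGroup E] [InnerProductSpace ℝ E] [FiniteDimensional ℝ E]
  [MeasurableSpace E] [BorelSpace E]

/-- Directional derivatives of a Lipschitz function are essentially bounded, and these vanish off a
set of finite measure. -/
theorem memLp_lineDeriv_of_hasCompactSupport {f : E → ℝ} {K : ℝ≥0} (hf : LipschitzWith K f)
    (hc : HasCompactSupport f) (v : E) :
    MemLp (fun x => ((lineDeriv ℝ f x v : ℝ) : ℂ)) 2 (volume : Measure E) := by
  have h : MemLp (fun x => lineDeriv ℝ f x v) 2 (volume : Measure E) :=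
    (hf.memLp_lineDeriv v).mono_exponent_of_measure_support_ne_top
      (fun x hx => lineDeriv_eq_zero_of_notMem_tsupport hx v)
      (IsCompact.measure_lt_top hc).ne le_top
  exact h.ofReal

/-- Integration by parts of a Lipschitz function with compact support against a Schwartz function. -/
theorem integral_lineDeriv_schwartz {f : E → ℝ} {K : ℝ≥0} (hf : LipschitzWith K f)
    (hc : HasCompactSupport f) (ψ : 𝓢(E, ℂ)) (v : E) :
    ∫ x, (∂_{v} ψ) x * (f x : ℂ) = -∫ x, ψ x * ((lineDeriv ℝ f x v : ℝ) : ℂ) := by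
  obtain ⟨D, hD⟩ := schwartz_lipschitz ψ
  -- Integration by parts is available for real Lipschitz functions; `L` will be the real and the
  -- imaginary part.
  have key : ∀ L : ℂ →L[ℝ] ℝ, ∫ x, lineDeriv ℝ (fun x => L (ψ x)) x v * f x
      = -∫ x, L (ψ x) * lineDeriv ℝ f x v := fun L => by
    have hL : LipschitzWith (‖L‖₊ * D) (fun x => L (ψ x)) := L.lipschitz.comp hD
    rw [hL.integral_lineDeriv_mul_eq hf hc v, ← integral_neg]
    refine integral_congr_ae (Eventually.of_forall fun x => ?_)
    simp only [lineDeriv_neg]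
    ring
  have hder : ∀ (L : ℂ →L[ℝ] ℝ) x, lineDeriv ℝ (fun x => L (ψ x)) x v = L ((∂_{v} ψ) x) :=
    fun L x => by
      have h1 : HasFDerivAt (fun x => L (ψ x)) (L ∘L fderiv ℝ ψ x) x :=
        L.hasFDerivAt.comp x ψ.differentiableAt.hasFDerivAt
      rw [h1.differentiableAt.lineDeriv_eq_fderiv, h1.fderiv]
      rfl
  have hi1 : Integrable (fun x => (∂_{v} ψ) x * (f x : ℂ)) (volume : Measure E) :=
    ((∂_{v} ψ).continuous.mul
      (Complex.continuous_ofReal.comp hf.continuous)).integrable_of_hasCompactSupport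
      (HasCompactSupport.mul_left (hc.comp_left (g := Complex.ofReal) rfl))
  have hi2 : Integrable (fun x => ψ x * ((lineDeriv ℝ f x v : ℝ) : ℂ)) (volume : Measure E) :=
    (ψ.memLp 2 volume).integrable_mul (memLp_lineDeriv_of_hasCompactSupport hf hc v)
  have hre : ∀ (z : ℂ) (r : ℝ), Complex.reCLM (z * r) = Complex.reCLM z * r := fun z r => by
    simp
  have him : ∀ (z : ℂ) (r : ℝ), Complex.imCLM (z * r) = Complex.imCLM z * r := fun z r => by
    simp
  apply Complex.ext
  · have h1 := Complex.reCLM.integral_comp_comm hi1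
    have h2 := Complex.reCLM.integral_comp_comm hi2
    have h3 := key Complex.reCLM
    simp only [hder] at h3
    simp only [hre] at h1 h2
    rw [Complex.neg_re]
    exact h1.symm.trans (h3.trans (congrArg Neg.neg h2))
  · have h1 := Complex.imCLM.integral_comp_comm hi1
    have h2 := Complex.imCLM.integral_comp_comm hi2
    have h3 := key Complex.imCLM
    simp only [hder] at h3
    simp only [him] at h1 h2
    rw [Complex.neg_im]
    exact h1.symm.trans (h3.trans (congrArg Neg.neg h2))

/-- The `L²` Fourier transform turns the derivative of a compactly supported Lipschitz function into
multiplication. -/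
theorem fourier_lineDeriv_ae_eq {f : E → ℝ} {K : ℝ≥0} (hf : LipschitzWith K f)
    (hc : HasCompactSupport f) (hfm : MemLp (fun x => (f x : ℂ)) 2 (volume : Measure E)) (v : E) :
    (𝓕 ((memLp_lineDeriv_of_hasCompactSupport hf hc v).toLp _) : Lp ℂ 2 (volume : Measure E))
      =ᵐ[volume] fun η => (2 * Real.pi * Complex.I) * ((inner ℝ η v : ℝ) : ℂ) *
        (𝓕 (hfm.toLp _) : Lp ℂ 2 (volume : Measure E)) η := by
  set F := hfm.toLp (fun x => (f x : ℂ))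
  set V := (memLp_lineDeriv_of_hasCompactSupport hf hc v).toLp
    (fun x => ((lineDeriv ℝ f x v : ℝ) : ℂ))
  -- The almost everywhere derivative is the distributional one, so the multiplication rule for
  -- tempered distributions applies. Testing with smooth compactly supported functions then brings
  -- the identity back to functions.
  have hdist : ∂_{v} (F : 𝓢'(E, ℂ)) = (V : 𝓢'(E, ℂ)) := by
    ext ψ
    rw [TemperedDistribution.lineDerivOp_apply_apply, map_neg, Lp.toTemperedDistribution_apply,
      Lp.toTemperedDistribution_apply]
    have e1 : ∫ x, (∂_{v} ψ) x • F x = ∫ x, (∂_{v} ψ) x * (f x : ℂ) :=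
      integral_congr_ae (hfm.coeFn_toLp.mono fun x hx => by simp only [F, hx, smul_eq_mul])
    have e2 : ∫ x, ψ x • V x = ∫ x, ψ x * ((lineDeriv ℝ f x v : ℝ) : ℂ) :=
      integral_congr_ae ((memLp_lineDeriv_of_hasCompactSupport hf hc v).coeFn_toLp.mono
        fun x hx => by simp only [V, hx, smul_eq_mul])
    rw [e1, e2, integral_lineDeriv_schwartz hf hc, neg_neg]
  have hfour : ((𝓕 V : Lp ℂ 2 (volume : Measure E)) : 𝓢'(E, ℂ)) =
      (2 * Real.pi * Complex.I) • TemperedDistribution.smulLeftCLM ℂ (fun x => ((inner ℝ x v : ℝ) : ℂ))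
        ((𝓕 F : Lp ℂ 2 (volume : Measure E)) : 𝓢'(E, ℂ)) := by
    rw [← Lp.fourier_toTemperedDistribution_eq, ← Lp.fourier_toTemperedDistribution_eq, ← hdist,
      TemperedDistribution.fourier_lineDerivOp_eq]
  have hli : LocallyIntegrable (𝓕 F : Lp ℂ 2 (volume : Measure E)) volume :=
    (Lp.memLp _).locallyIntegrable (by norm_num)
  have htg : (fun x : E => ((inner ℝ x v : ℝ) : ℂ)).HasTemperateGrowth := by
    have : (inner ℝ · v : E → ℝ).HasTemperateGrowth := by fun_prop
    fun_prop
  refine ae_eq_of_integral_contDiff_smul_eq ((Lp.memLp _).locallyIntegrable (by norm_num)) ?_ ?_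
  · rw [← locallyIntegrableOn_univ] at hli ⊢
    exact hli.continuousOn_mul (by fun_prop) isOpen_univ.isLocallyClosed
  · intro g g_smooth g_cpt
    have hg₁ : HasCompactSupport (Complex.ofRealCLM ∘ g) := g_cpt.comp_left rfl
    have hg₂ : ContDiff ℝ ∞ (Complex.ofRealCLM ∘ g) := by fun_prop
    have h := congrArg (fun T : 𝓢'(E, ℂ) => T (hg₁.toSchwartzMap hg₂)) hfour
    simp only [smul_apply, TemperedDistribution.smulLeftCLM_apply_apply,
      Lp.toTemperedDistribution_apply, smul_eq_mul] at h
    rw [← integral_const_mul] at h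
    refine Eq.trans ?_ (h.trans ?_)
    · refine integral_congr_ae (Eventually.of_forall fun x => ?_)
      simp
    · refine integral_congr_ae (Eventually.of_forall fun x => ?_)
      simp only [SchwartzMap.smulLeftCLM_apply_apply htg]
      simp
      ring

/-- Up to the factor `2πi`, the product of `⟨η, v⟩` and the transform is the transform of an `L²`
derivative, hence square integrable. -/
theorem integrable_inner_sq_mul_fourier {f : E → ℝ} {K : ℝ≥0} (hf : LipschitzWith K f)
    (hc : HasCompactSupport f) (hfm : MemLp (fun x => (f x : ℂ)) 2 (volume : Measure E)) (v : E) :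
    Integrable (fun η => (inner ℝ η v) ^ 2 *
      ‖(𝓕 (hfm.toLp _) : Lp ℂ 2 (volume : Measure E)) η‖ ^ 2) := by
  have h := (Lp.memLp (𝓕 ((memLp_lineDeriv_of_hasCompactSupport hf hc v).toLp _) :
    Lp ℂ 2 (volume : Measure E))).integrable_norm_pow (by norm_num)
  refine (h.const_mul ((2 * Real.pi) ^ 2)⁻¹).congr
    ((fourier_lineDeriv_ae_eq hf hc hfm v).mono fun η hη => ?_)
  have e : ‖(𝓕 ((memLp_lineDeriv_of_hasCompactSupport hf hc v).toLp _) :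
      Lp ℂ 2 (volume : Measure E)) η‖ ^ 2 = (2 * Real.pi) ^ 2 * ((inner ℝ η v) ^ 2 *
      ‖(𝓕 (hfm.toLp _) : Lp ℂ 2 (volume : Measure E)) η‖ ^ 2) := by
    rw [hη]
    simp only [norm_mul, Complex.norm_I, Complex.norm_real, mul_pow, Complex.norm_ofNat]
    rw [Real.norm_eq_abs, Real.norm_eq_abs, sq_abs, sq_abs]
    ring
  dsimp only
  rw [e, inv_mul_cancel_left₀ (by positivity)]

end Lipschitz
/-! ### Weights and the symbol of the Dirichlet-to-Neumann operator -/

/-- The square root of `|ω|² + |ξ'|²`. -/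
noncomputable def freqNorm (σ : ℝ) (η : SpaceTime) : ℝ := Real.sqrt (‖omega σ η‖ ^ 2 + xiSq η)

theorem xiSq_nonneg (η : SpaceTime) : 0 ≤ xiSq η := sq_nonneg _

theorem norm_omega_sq (σ : ℝ) (η : SpaceTime) :
    ‖omega σ η‖ ^ 2 = (2 * Real.pi * time η) ^ 2 + σ ^ 2 := by
  rw [← Complex.normSq_eq_norm_sq, Complex.normSq_apply]
  simp only [omega, Complex.add_re, Complex.ofReal_re, Complex.mul_re, Complex.I_re, mul_zero,
    Complex.ofReal_im, Complex.I_im, mul_one, sub_self, add_zero, Complex.add_im, Complex.mul_im,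
    zero_add]
  ring

theorem le_norm_omega {σ : ℝ} (η : SpaceTime) : σ ≤ ‖omega σ η‖ := by
  refine (abs_le_of_sq_le_sq' ?_ (norm_nonneg _)).2
  rw [norm_omega_sq]
  nlinarith [sq_nonneg (2 * Real.pi * time η)]

theorem freqNorm_sq (σ : ℝ) (η : SpaceTime) : freqNorm σ η ^ 2 = ‖omega σ η‖ ^ 2 + xiSq η :=
  Real.sq_sqrt (add_nonneg (sq_nonneg _) (xiSq_nonneg η))

theorem freqNorm_nonneg (σ : ℝ) (η : SpaceTime) : 0 ≤ freqNorm σ η := Real.sqrt_nonneg _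

theorem norm_omega_le_freqNorm (σ : ℝ) (η : SpaceTime) : ‖omega σ η‖ ≤ freqNorm σ η :=
  Real.le_sqrt_of_sq_le (by linarith [xiSq_nonneg η])

theorem weight_zero_half (σ : ℝ) (η : SpaceTime) : weight σ 0 (1 / 2) η = freqNorm σ η := by
  rw [weight, mul_zero, Real.rpow_zero, one_mul, freqNorm, Real.sqrt_eq_rpow]

theorem weight_neg_half_half (σ : ℝ) (η : SpaceTime) :
    weight σ (-(1 / 2)) (1 / 2) η = ‖omega σ η‖⁻¹ * freqNorm σ η := by
  rw [weight, freqNorm, Real.sqrt_eq_rpow, show (2 : ℝ) * -(1 / 2) = -1 by norm_num,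
    Real.rpow_neg_one]

theorem weight_three_halves (σ : ℝ) (η : SpaceTime) :
    weight σ (3 / 2) (-(1 / 2)) η = ‖omega σ η‖ ^ 3 * (freqNorm σ η)⁻¹ := by
  rw [weight, freqNorm, Real.sqrt_eq_rpow, show (2 : ℝ) * (3 / 2) = (3 : ℕ) by norm_num,
    Real.rpow_natCast, Real.rpow_neg (add_nonneg (sq_nonneg _) (xiSq_nonneg η))]

theorem pos_sq (η : SpaceTime) : ‖pos η‖ ^ 2 = η 1 ^ 2 + η 2 ^ 2 := by
  rw [EuclideanSpace.norm_sq_eq]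
  simp [pos, Fin.sum_univ_two]

theorem freqNorm_sq_eq (σ : ℝ) (η : SpaceTime) :
    freqNorm σ η ^ 2 = σ ^ 2 + (2 * Real.pi) ^ 2 * (η 0 ^ 2 + η 1 ^ 2 + η 2 ^ 2) := by
  rw [freqNorm_sq, norm_omega_sq, xiSq, mul_pow _ ‖pos η‖, pos_sq, time]
  ring

theorem continuous_time : Continuous time := by
  unfold time; fun_prop

theorem continuous_pos : Continuous pos := by
  unfold pos
  refine (PiLp.continuous_toLp 2 _).comp (continuous_pi fun i => ?_)
  fin_cases i <;> simp <;> fun_prop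

theorem continuous_omega (σ : ℝ) : Continuous (omega σ) := by
  have := continuous_time
  unfold omega; fun_prop

theorem continuous_xiSq : Continuous xiSq := by
  have := continuous_pos
  unfold xiSq; fun_prop

theorem continuous_freqNorm (σ : ℝ) : Continuous (freqNorm σ) := by
  have := continuous_omega σ
  have := continuous_xiSq
  unfold freqNorm; fun_prop

theorem measurable_rootSymbol (σ : ℝ) : Measurable (rootSymbol σ) := by
  have := (continuous_omega σ).measurable
  have := continuous_xiSq.measurable
  unfold rootSymbol; fun_prop

/-- The principal root halves an argument in `(-π, π]`. Since `Γ` is `i` times such a root, this is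
the choice of branch for `Γ`. -/
theorem re_cpow_half_nonneg (z : ℂ) : 0 ≤ (z ^ (1 / 2 : ℂ)).re := by
  have h : (1 / 2 : ℂ) = ((1 / 2 : ℝ) : ℂ) := by norm_num
  rw [h, Complex.cpow_ofReal_re]
  refine mul_nonneg (Real.rpow_nonneg (norm_nonneg _) _) (Real.cos_nonneg_of_mem_Icc ⟨?_, ?_⟩)
  · linarith [Complex.neg_pi_lt_arg z]
  · linarith [Complex.arg_le_pi z]

theorem cpow_half_sq (z : ℂ) : (z ^ (1 / 2 : ℂ)) ^ 2 = z := by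
  have := Complex.cpow_nat_inv_pow z (two_ne_zero)
  rw [one_div]
  exact_mod_cast this

/-- The symbol has order one, as `|Γ|² = | |ξ|² - ω² |`. This is why the form is finite on functions
of finite trace norm. -/
theorem norm_rootSymbol_le (σ : ℝ) (η : SpaceTime) : ‖rootSymbol σ η‖ ≤ freqNorm σ η := by
  refine Real.le_sqrt_of_sq_le ?_
  rw [rootSymbol, norm_mul, Complex.norm_I, one_mul, ← norm_pow, cpow_half_sq]
  refine (norm_sub_le _ _).trans ?_
  rw [Complex.norm_real, norm_pow, Real.norm_of_nonneg (xiSq_nonneg η), add_comm]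

/-- The lower bound for the symbol `-iΓ` of the Dirichlet-to-Neumann operator. -/
theorem le_re_symbol {σ : ℝ} (hσ : 0 < σ) (η : SpaceTime) :
    σ * (‖omega σ η‖⁻¹ * freqNorm σ η) ≤ (-Complex.I * rootSymbol σ η).re := by
  have hI : -Complex.I * rootSymbol σ η = (((xiSq η : ℝ) : ℂ) - omega σ η ^ 2) ^ (1 / 2 : ℂ) := by
    rw [rootSymbol, ← mul_assoc, neg_mul, Complex.I_mul_I, neg_neg, one_mul]
  rw [hI]
  set X := xiSq η with hX
  have hX0 : 0 ≤ X := xiSq_nonneg η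
  set q := (((X : ℝ) : ℂ) - omega σ η ^ 2) ^ (1 / 2 : ℂ) with hq
  have hq2 : q ^ 2 = ((X : ℝ) : ℂ) - omega σ η ^ 2 := cpow_half_sq _
  have hq0 : 0 ≤ q.re := re_cpow_half_nonneg _
  set s := 2 * Real.pi * time η with hs
  have hω : omega σ η = ((-s : ℝ) : ℂ) + (σ : ℂ) * Complex.I := by
    rw [omega, hs]; congr 2; ring
  have hW := norm_omega_sq σ η
  rw [← hs] at hW
  have hWpos : 0 < s ^ 2 + σ ^ 2 := by positivity
  -- Real and imaginary parts of `q² = X - ω²`: they determine the difference and the product of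
  -- `q.re²` and `q.im²`.
  have hre : q.re ^ 2 - q.im ^ 2 = X - s ^ 2 + σ ^ 2 := by
    have := congrArg Complex.re hq2
    rw [hω] at this
    simp only [sq, Complex.mul_re, Complex.sub_re, Complex.ofReal_re, Complex.add_re,
      Complex.add_im, Complex.ofReal_im, Complex.I_re, Complex.I_im, Complex.mul_im] at this
    linarith
  have him : q.re * q.im = s * σ := by
    have := congrArg Complex.im hq2
    rw [hω] at this
    simp only [sq, Complex.mul_re, Complex.sub_im, Complex.ofReal_re, Complex.add_re,
      Complex.add_im, Complex.ofReal_im, Complex.I_re, Complex.I_im, Complex.mul_im] at this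
    linarith
  have hprod : q.re ^ 2 * q.im ^ 2 = s ^ 2 * σ ^ 2 := by rw [← mul_pow, him, mul_pow]
  refine (abs_le_of_sq_le_sq' ?_ hq0).2
  rw [mul_pow, mul_pow, inv_pow, freqNorm_sq, hW]
  set Y := X / (s ^ 2 + σ ^ 2) with hY
  have hXY : X = Y * (s ^ 2 + σ ^ 2) := by rw [hY]; field_simp
  have hP : σ ^ 2 * ((s ^ 2 + σ ^ 2)⁻¹ * (s ^ 2 + σ ^ 2 + X)) = σ ^ 2 * (1 + Y) := by
    rw [hY]; field_simp
  have hY0 : 0 ≤ Y := div_nonneg hX0 hWpos.le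
  rw [hP]
  -- With `Y = X/|ω|²` the claim is `q.re² ≥ P = σ²(1 + Y)`. If it failed, `hre` would bound `q.im²`
  -- strictly by `s²(1 - Y)`, and the product `s²σ²` would be less than `s²σ²(1 - Y²)`.
  by_contra! hlt
  set P := σ ^ 2 * (1 + Y) with hPdef
  have hP0 : 0 < P := by positivity
  have h1 : q.im ^ 2 < P - (X - s ^ 2 + σ ^ 2) := by linarith
  have h2 : q.re ^ 2 * q.im ^ 2 < P * (P - (X - s ^ 2 + σ ^ 2)) :=
    (mul_le_mul_of_nonneg_right hlt.le (sq_nonneg _)).trans_lt (mul_lt_mul_of_pos_left h1 hP0)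
  have h3 : P * (P - (X - s ^ 2 + σ ^ 2)) = s ^ 2 * σ ^ 2 - s ^ 2 * σ ^ 2 * Y ^ 2 := by
    rw [hPdef]
    nth_rewrite 1 [hXY]
    ring
  have h4 : 0 ≤ s ^ 2 * σ ^ 2 * Y ^ 2 := by positivity
  linarith

/-! ### The Laplace-Fourier transform -/

theorem aestronglyMeasurable_lapFourier (σ : ℝ) (u : SpaceTime → ℝ) :
    AEStronglyMeasurable (lapFourier σ u) (volume : Measure SpaceTime) := by
  unfold lapFourier
  split_ifs
  · exact (Lp.memLp _).aestronglyMeasurable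
  · exact aestronglyMeasurable_const

theorem damped_add (σ : ℝ) (u v : SpaceTime → ℝ) :
    damped σ (u + v) = damped σ u + damped σ v := by
  ext z; simp [damped, mul_add]

theorem damped_smul (σ c : ℝ) (u : SpaceTime → ℝ) :
    damped σ (c • u) = (c : ℂ) • damped σ u := by
  ext z; simp [damped]; ring

/-- Only almost everywhere, because `lapFourier` picks representatives of `L²` classes; without
square integrability its default value `0` would break additivity. -/
theorem lapFourier_add {σ : ℝ} {u v : SpaceTime → ℝ} (hu : MemLp (damped σ u) 2 volume)
    (hv : MemLp (damped σ v) 2 volume) :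
    lapFourier σ (u + v) =ᵐ[volume] lapFourier σ u + lapFourier σ v := by
  have h : MemLp (damped σ (u + v)) 2 volume := damped_add σ u v ▸ hu.add hv
  have e : h.toLp _ = hu.toLp _ + hv.toLp _ := by
    rw [← MemLp.toLp_add]
    exact MemLp.toLp_congr _ _ (by rw [damped_add])
  simp only [lapFourier, dif_pos hu, dif_pos hv, dif_pos h, e, FourierTransform.fourier_add]
  exact Lp.coeFn_add _ _

theorem lapFourier_smul {σ : ℝ} (c : ℝ) {u : SpaceTime → ℝ} (hu : MemLp (damped σ u) 2 volume) :
    lapFourier σ (c • u) =ᵐ[volume] (c : ℂ) • lapFourier σ u := by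
  have h : MemLp (damped σ (c • u)) 2 volume := damped_smul σ c u ▸ hu.const_smul (c : ℂ)
  have e : h.toLp _ = (c : ℂ) • hu.toLp _ := by
    rw [← MemLp.toLp_const_smul]
    exact MemLp.toLp_congr _ _ (by rw [damped_smul])
  simp only [lapFourier, dif_pos hu, dif_pos h, e, FourierTransform.fourier_smul]
  exact Lp.coeFn_smul _ _

theorem norm_damped_sq (σ : ℝ) (u : SpaceTime → ℝ) (z : SpaceTime) :
    ‖damped σ u z‖ ^ 2 = Real.exp (-2 * σ * time z) * (u z * u z) := by
  rw [damped, Complex.norm_real, Real.norm_eq_abs, sq_abs, mul_pow, ← Real.exp_nat_mul, ← sq]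
  congr 2
  push_cast; ring

theorem integral_norm_sq_eq {α F : Type*} [MeasurableSpace α] {ν : Measure α}
    [NormedAddCommGroup F] [InnerProductSpace ℝ F] (f : Lp F 2 ν) :
    ∫ z, ‖f z‖ ^ 2 ∂ν = ‖f‖ ^ 2 := by
  rw [← real_inner_self_eq_norm_sq, L2.inner_def]
  simp only [real_inner_self_eq_norm_sq]

/-- Plancherel's formula. -/
theorem integral_norm_lapFourier_sq {σ : ℝ} {u : SpaceTime → ℝ}
    (hu : MemLp (damped σ u) 2 volume) : ∫ η, ‖lapFourier σ u η‖ ^ 2 = innerS σ u u := by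
  have h1 : lapFourier σ u = (𝓕 (hu.toLp (damped σ u)) : Lp ℂ 2 (volume : Measure SpaceTime)) := by
    rw [lapFourier, dif_pos hu]
  rw [h1, integral_norm_sq_eq, Lp.norm_fourier_eq, ← integral_norm_sq_eq, innerS]
  refine integral_congr_ae (hu.coeFn_toLp.mono fun z hz => ?_)
  simp only [hz, norm_damped_sq]

theorem integrable_norm_lapFourier_sq (σ : ℝ) (u : SpaceTime → ℝ) :
    Integrable (fun η => ‖lapFourier σ u η‖ ^ 2) := by
  unfold lapFourier
  split_ifs
  · exact (Lp.memLp _).integrable_norm_pow (by norm_num)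
  · simp

/-- The functions with finite norm `‖u‖_{0,1/2,σ,*}`. -/
structure FiniteTraceNorm (σ : ℝ) (u : SpaceTime → ℝ) : Prop where
  memLp : MemLp (damped σ u) 2 (volume : Measure SpaceTime)
  finite : Integrable (fun η => freqNorm σ η * ‖lapFourier σ u η‖ ^ 2)

theorem MemTraceSpace.finiteTraceNorm {σ : ℝ} {G : Set Plane} {u : SpaceTime → ℝ}
    (h : MemTraceSpace σ G u) : FiniteTraceNorm σ u :=
  ⟨h.memLp, by simpa only [weight_zero_half] using h.finite⟩

/-- The form `Re ⟨𝒮_σ u, v⟩_σ`. -/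
noncomputable def dtnForm (σ μ : ℝ) (u v : SpaceTime → ℝ) : ℝ := (pairing σ (dtnTransform σ μ u) v).re

section pairings

variable {σ μ : ℝ} {u u' v v' : SpaceTime → ℝ}

theorem FiniteTraceNorm.integrable_dtn (hu : FiniteTraceNorm σ u) (hv : FiniteTraceNorm σ v) :
    Integrable (fun η => dtnTransform σ μ u η * conj (lapFourier σ v η)) := by
  refine ((hu.finite.add hv.finite).const_mul |μ|).mono' ?_ (Eventually.of_forall fun η => ?_)
  · refine AEStronglyMeasurable.mul ?_
      (Complex.continuous_conj.comp_aestronglyMeasurable (aestronglyMeasurable_lapFourier σ v))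
    exact ((measurable_rootSymbol σ).const_mul _).aestronglyMeasurable.mul
      (aestronglyMeasurable_lapFourier σ u)
  · simp only [dtnTransform, norm_mul, norm_neg, Complex.norm_I, one_mul, Complex.norm_real,
      RCLike.norm_conj, Pi.add_apply, Real.norm_eq_abs, mul_assoc]
    refine mul_le_mul_of_nonneg_left ?_ (abs_nonneg μ)
    have h1 := norm_rootSymbol_le σ η
    set a := ‖lapFourier σ u η‖
    set b := ‖lapFourier σ v η‖
    have h2 : 0 ≤ a * b := mul_nonneg (norm_nonneg _) (norm_nonneg _)
    have h3 : a * b ≤ a ^ 2 + b ^ 2 := by nlinarith [sq_nonneg (a - b)]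
    calc ‖rootSymbol σ η‖ * (a * b) ≤ freqNorm σ η * (a * b) := mul_le_mul_of_nonneg_right h1 h2
      _ ≤ freqNorm σ η * (a ^ 2 + b ^ 2) := mul_le_mul_of_nonneg_left h3 (freqNorm_nonneg σ η)
      _ = _ := by ring

theorem FiniteTraceNorm.integrable_force (hσ : 0 < σ) {g : SpaceTime → ℂ}
    (hg : IsForceTransform σ g) (hv : FiniteTraceNorm σ v) :
    Integrable (fun η => g η * conj (lapFourier σ v η)) := by
  have hgf := hg.finite
  simp only [weight_three_halves] at hgf
  refine (hgf.add (hv.finite.const_mul (σ ^ 3)⁻¹)).mono' ?_ (Eventually.of_forall fun η => ?_)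
  · exact hg.measurable.mul
      (Complex.continuous_conj.comp_aestronglyMeasurable (aestronglyMeasurable_lapFourier σ v))
  · simp only [norm_mul, RCLike.norm_conj, Pi.add_apply]
    set a := ‖g η‖
    set b := ‖lapFourier σ v η‖
    have hω := le_norm_omega (σ := σ) η
    have hR := hσ.trans_le (hω.trans (norm_omega_le_freqNorm σ η))
    have h3 : σ ^ 3 ≤ ‖omega σ η‖ ^ 3 := pow_le_pow_left₀ hσ.le hω 3
    set R := freqNorm σ η
    calc a * b ≤ σ ^ 3 * R⁻¹ * a ^ 2 + (σ ^ 3)⁻¹ * (R * b ^ 2) := by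
          -- Young's inequality with this `c` balances the dual weights; `σ³ ≤ |ω|³` then gives the
          -- weight of the force norm.
          set c := σ ^ 3 * R⁻¹ with hc
          have hc0 : 0 < c := by positivity
          have e : (σ ^ 3)⁻¹ * (R * b ^ 2) = c⁻¹ * b ^ 2 := by
            rw [hc, mul_inv, inv_inv]; ring
          rw [e]
          have h0 : 0 ≤ c⁻¹ * (c * a - b) ^ 2 := by positivity
          have h1 : c⁻¹ * (c * a - b) ^ 2 = c * a ^ 2 - 2 * (a * b) + c⁻¹ * b ^ 2 := by
            field_simp
            ring
          have h2 : 0 ≤ a * b := mul_nonneg (norm_nonneg _) (norm_nonneg _)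
          linarith
      _ ≤ _ := by gcongr

theorem FiniteTraceNorm.add (hu : FiniteTraceNorm σ u) (hv : FiniteTraceNorm σ v) :
    FiniteTraceNorm σ (u + v) := by
  refine ⟨damped_add σ u v ▸ hu.memLp.add hv.memLp, ?_⟩
  refine ((hu.finite.add hv.finite).const_mul 2).mono' ?_
    ((lapFourier_add hu.memLp hv.memLp).mono fun η hη => ?_)
  · exact (continuous_freqNorm σ).aestronglyMeasurable.mul
      ((aestronglyMeasurable_lapFourier σ _).norm.pow 2)
  · rw [hη, Real.norm_of_nonneg (mul_nonneg (freqNorm_nonneg σ η) (sq_nonneg _)), Pi.add_apply,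
      Pi.add_apply, ← mul_add, mul_left_comm]
    refine mul_le_mul_of_nonneg_left ?_ (freqNorm_nonneg σ η)
    have h1 := norm_add_le (lapFourier σ u η) (lapFourier σ v η)
    have h2 := pow_le_pow_left₀ (norm_nonneg _) h1 2
    nlinarith [sq_nonneg (‖lapFourier σ u η‖ - ‖lapFourier σ v η‖)]

theorem FiniteTraceNorm.smul (c : ℝ) (hu : FiniteTraceNorm σ u) : FiniteTraceNorm σ (c • u) := by
  refine ⟨damped_smul σ c u ▸ hu.memLp.const_smul (c : ℂ), ?_⟩
  refine (hu.finite.const_mul (c ^ 2)).congr ((lapFourier_smul c hu.memLp).mono fun η hη => ?_)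
  simp only [hη, Pi.smul_apply, norm_smul, Complex.norm_real, Real.norm_eq_abs, mul_pow, sq_abs]
  ring

theorem dtnForm_add_left (hu : FiniteTraceNorm σ u) (hu' : FiniteTraceNorm σ u')
    (hv : FiniteTraceNorm σ v) :
    dtnForm σ μ (u + u') v = dtnForm σ μ u v + dtnForm σ μ u' v := by
  rw [dtnForm, dtnForm, dtnForm, ← Complex.add_re, pairing, pairing, pairing,
    ← integral_add (hu.integrable_dtn hv) (hu'.integrable_dtn hv)]
  congr 1
  refine integral_congr_ae ((lapFourier_add hu.memLp hu'.memLp).mono fun η hη => ?_)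
  simp only [dtnTransform, hη, Pi.add_apply]
  ring

theorem dtnForm_smul_left (c : ℝ) (hu : FiniteTraceNorm σ u) :
    dtnForm σ μ (c • u) v = c * dtnForm σ μ u v := by
  rw [dtnForm, dtnForm, ← Complex.re_ofReal_mul, pairing, pairing, ← integral_const_mul]
  congr 1
  refine integral_congr_ae ((lapFourier_smul c hu.memLp).mono fun η hη => ?_)
  simp only [dtnTransform, hη, Pi.smul_apply, smul_eq_mul]
  ring

theorem re_pairing_add {g : SpaceTime → ℂ} (hu : MemLp (damped σ u) 2 volume)
    (hv : MemLp (damped σ v) 2 volume)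
    (h1 : Integrable (fun η => g η * conj (lapFourier σ u η)))
    (h2 : Integrable (fun η => g η * conj (lapFourier σ v η))) :
    (pairing σ g (u + v)).re = (pairing σ g u).re + (pairing σ g v).re := by
  rw [← Complex.add_re, pairing, pairing, pairing, ← integral_add h1 h2]
  congr 1
  refine integral_congr_ae ((lapFourier_add hu hv).mono fun η hη => ?_)
  simp only [hη, Pi.add_apply, map_add]
  ring

theorem re_pairing_smul {g : SpaceTime → ℂ} (c : ℝ) (hu : MemLp (damped σ u) 2 volume) :
    (pairing σ g (c • u)).re = c * (pairing σ g u).re := by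
  rw [← Complex.re_ofReal_mul, pairing, pairing, ← integral_const_mul]
  congr 1
  refine integral_congr_ae ((lapFourier_smul c hu).mono fun η hη => ?_)
  simp only [hη, Pi.smul_apply, smul_eq_mul, map_mul, Complex.conj_ofReal]
  ring

theorem FiniteTraceNorm.integrable_weight (hσ : 0 < σ) (hu : FiniteTraceNorm σ u) :
    Integrable (fun η => weight σ (-(1 / 2)) (1 / 2) η * ‖lapFourier σ u η‖ ^ 2) := by
  simp only [weight_neg_half_half]
  refine (hu.finite.const_mul σ⁻¹).mono' ?_ (Eventually.of_forall fun η => ?_)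
  · have hc : Continuous (fun η => ‖omega σ η‖⁻¹ * freqNorm σ η) :=
      ((continuous_omega σ).norm.inv₀ fun η => (hσ.trans_le (le_norm_omega η)).ne').mul
        (continuous_freqNorm σ)
    exact hc.aestronglyMeasurable.mul ((aestronglyMeasurable_lapFourier σ _).norm.pow 2)
  · have := freqNorm_nonneg σ η
    rw [Real.norm_of_nonneg (by positivity), mul_assoc]
    exact mul_le_mul_of_nonneg_right (inv_anti₀ hσ (le_norm_omega η)) (by positivity)

theorem sobolevNorm_sq (σ s r : ℝ) (u : SpaceTime → ℝ) : sobolevNorm σ s r u ^ 2 =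
    ∫ η : SpaceTime, weight σ s r η * ‖lapFourier σ u η‖ ^ 2 := by
  refine Real.sq_sqrt (integral_nonneg fun η => mul_nonneg ?_ (sq_nonneg _))
  exact mul_nonneg (Real.rpow_nonneg (norm_nonneg _) _)
    (Real.rpow_nonneg (add_nonneg (sq_nonneg _) (xiSq_nonneg η)) _)

/-- The weight `|ω|⁻¹ (|ω|² + |ξ|²)^{1/2}` is at least one. With Plancherel this carries a
coercivity constant over to the weighted `L²` norm without loss, so that the bound `ρ < 2C` is the
right one. -/
theorem FiniteTraceNorm.innerS_le (hσ : 0 < σ) (hu : FiniteTraceNorm σ u) :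
    innerS σ u u ≤ sobolevNorm σ (-(1 / 2)) (1 / 2) u ^ 2 := by
  rw [sobolevNorm_sq, ← integral_norm_lapFourier_sq hu.memLp]
  refine integral_mono (integrable_norm_lapFourier_sq σ u) (hu.integrable_weight hσ) fun η => ?_
  dsimp only
  rw [weight_neg_half_half]
  refine le_mul_of_one_le_left (sq_nonneg _) ?_
  rw [← div_eq_inv_mul, one_le_div (hσ.trans_le (le_norm_omega η))]
  exact norm_omega_le_freqNorm σ η

/-- Coercivity of the Dirichlet-to-Neumann operator. -/
theorem isCoercivityConstant (hσ : 0 < σ) (hμ : 0 < μ) (G : Set Plane) :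
    IsCoercivityConstant σ μ G (μ * σ) := by
  refine ⟨mul_pos hμ hσ, fun φ hφ => ?_⟩
  have h := hφ.finiteTraceNorm
  have hi := h.integrable_dtn (μ := μ) h
  rw [sobolevNorm_sq, ← integral_const_mul]
  have hre : (pairing σ (dtnTransform σ μ φ) φ).re
      = ∫ η, (dtnTransform σ μ φ η * conj (lapFourier σ φ η)).re :=
    (Complex.reCLM.integral_comp_comm hi).symm
  rw [hre]
  refine integral_mono ((h.integrable_weight hσ).const_mul _) hi.re fun η => ?_
  -- The integrand is a nonnegative number times the symbol, so the pointwise bound on the symbol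
  -- suffices.
  have e : dtnTransform σ μ φ η * conj (lapFourier σ φ η)
      = ((μ * ‖lapFourier σ φ η‖ ^ 2 : ℝ) : ℂ) * (-Complex.I * rootSymbol σ η) := by
    rw [dtnTransform, mul_assoc, Complex.mul_conj, Complex.normSq_eq_norm_sq]
    push_cast
    ring
  dsimp only
  rw [e]
  change _ ≤ (_ : ℂ).re
  rw [Complex.re_ofReal_mul, weight_neg_half_half]
  have := mul_le_mul_of_nonneg_left (le_re_symbol hσ η)
    (mul_nonneg hμ.le (sq_nonneg ‖lapFourier σ φ η‖))
  refine le_trans (le_of_eq ?_) this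
  ring

end pairings

/-- Damped Lipschitz functions with compact support have finite trace norm. -/
theorem finiteTraceNorm_of_lipschitz {σ : ℝ} {u : SpaceTime → ℝ} {K : NNReal}
    (hf : LipschitzWith K (fun z => Real.exp (-σ * time z) * u z))
    (hc : HasCompactSupport (fun z => Real.exp (-σ * time z) * u z)) : FiniteTraceNorm σ u := by
  have hm : MemLp (damped σ u) 2 (volume : Measure SpaceTime) :=
    (Complex.continuous_ofReal.comp hf.continuous).memLp_of_hasCompactSupport
      (hc.comp_left (g := Complex.ofReal) rfl)
  refine ⟨hm, ?_⟩
  have h1 : lapFourier σ u = (𝓕 (hm.toLp (damped σ u)) : Lp ℂ 2 (volume : Measure SpaceTime)) := by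
    rw [lapFourier, dif_pos hm]
  have hd : ∀ j : Fin 3, Integrable (fun η : SpaceTime => η j ^ 2 * ‖lapFourier σ u η‖ ^ 2) :=
    fun j => by
      have := integrable_inner_sq_mul_fourier hf hc hm (EuclideanSpace.single j (1 : ℝ))
      rw [h1]
      refine this.congr (Eventually.of_forall fun η => ?_)
      simp only [EuclideanSpace.inner_single_right, one_mul]
      rfl
  have h0 := integrable_norm_lapFourier_sq σ u
  refine ((h0.const_mul (1 + σ ^ 2)).add
    ((((hd 0).add (hd 1)).add (hd 2)).const_mul ((2 * Real.pi) ^ 2))).mono' ?_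
    (Eventually.of_forall fun η => ?_)
  · exact (continuous_freqNorm σ).aestronglyMeasurable.mul
      ((aestronglyMeasurable_lapFourier σ _).norm.pow 2)
  · have h2 := freqNorm_sq_eq σ η
    -- The trace norm is controlled by the full first-order norm, that is, by the function and its
    -- three coordinate derivatives.
    have h3 : freqNorm σ η ≤ 1 + freqNorm σ η ^ 2 := by nlinarith [sq_nonneg (freqNorm σ η - 1)]
    rw [Real.norm_of_nonneg (mul_nonneg (freqNorm_nonneg σ η) (sq_nonneg _))]
    refine (mul_le_mul_of_nonneg_right h3 (sq_nonneg _)).trans (le_of_eq ?_)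
    rw [h2]
    simp only [Pi.add_apply]
    ring

/-! ### The displacement space -/

section Cover

open Set

/-- A continuous real function that is Lipschitz on each set of a finite closed cover is Lipschitz. -/
theorem lipschitzWith_of_finite_closed_cover {V ι : Type*} [NormedAddCommGroup V]
    [NormedSpace ℝ V] [Finite ι] {f : V → ℝ} (hf : Continuous f) {F : ι → Set V}
    (hF : ∀ i, IsClosed (F i)) (hcov : ∀ x, ∃ i, x ∈ F i) {K : NNReal}
    (hK : ∀ i, LipschitzOnWith K f (F i)) : LipschitzWith K f := by
  have key : ∀ x y, f y - f x ≤ K * dist x y := fun x y => by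
    let ℓ : ℝ → V := AffineMap.lineMap x y
    have hℓ : Continuous ℓ := AffineMap.lineMap_continuous
    let g : ℝ → ℝ := fun t => f (ℓ t) - f x
    have hg : Continuous g := (hf.comp hℓ).sub continuous_const
    have main := image_le_of_liminf_slope_right_le_deriv_boundary (f := g) (a := 0) (b := 1)
      (B := fun t => K * dist x y * t) (B' := fun _ => K * dist x y) hg.continuousOn
      (by simp [g, ℓ]) (by fun_prop)
      (fun t _ => by
        simpa using ((hasDerivAt_id t).const_mul (K * dist x y)).hasDerivWithinAt)
      (fun t _ r hr => by
        -- By closedness and finiteness, pieces that miss `ℓ t` also miss nearby points. So each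
        -- nearby point shares a piece with `ℓ t`, which bounds the right slopes on the segment.
        have h1 : ∀ᶠ z in 𝓝 t, ∀ i, ℓ t ∉ F i → ℓ z ∉ F i := by
          rw [eventually_all]
          intro i
          by_cases hi : ℓ t ∈ F i
          · exact Eventually.of_forall fun z h => absurd hi h
          · have := ((hF i).isOpen_compl.preimage hℓ).mem_nhds (x := t) hi
            exact Eventually.mono this fun z hz _ => hz
        refine Eventually.frequently ?_
        filter_upwards [h1.filter_mono nhdsWithin_le_nhds, self_mem_nhdsWithin] with z hz htz
        obtain ⟨i, hi⟩ := hcov (ℓ z)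
        have hti : ℓ t ∈ F i := by
          by_contra hcon
          exact hz i hcon hi
        have htz' : 0 < z - t := sub_pos.2 htz
        have h2 := (hK i).dist_le_mul _ hi _ hti
        have h3 : dist (ℓ z) (ℓ t) = (z - t) * dist x y := by
          rw [dist_lineMap_lineMap, Real.dist_eq, abs_of_pos htz']
        rw [h3, Real.dist_eq] at h2
        have h4 := (le_abs_self _).trans h2
        refine lt_of_le_of_lt ?_ hr
        rw [slope_def_field, div_le_iff₀ htz']
        simp only [g]
        linarith)
    have := main (right_mem_Icc.2 zero_le_one)
    simpa [g, ℓ] using this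
  refine LipschitzWith.of_dist_le_mul fun x y => ?_
  rw [Real.dist_eq, abs_sub_le_iff]
  refine ⟨?_, key x y⟩
  rw [dist_comm]
  exact key y x

end Cover

theorem lipschitzWith_mul_of_bounded {V : Type*} [PseudoMetricSpace V] {f g : V → ℝ}
    {K L A B : NNReal} (hf : LipschitzWith K f) (hg : LipschitzWith L g) (hA : ∀ x, |f x| ≤ A)
    (hB : ∀ x, |g x| ≤ B) : LipschitzWith (A * L + K * B) (fun x => f x * g x) := by
  refine LipschitzWith.of_dist_le_mul fun x y => ?_
  have h1 := hf.dist_le_mul x y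
  have h2 := hg.dist_le_mul x y
  rw [Real.dist_eq] at h1 h2 ⊢
  have e : f x * g x - f y * g y = f x * (g x - g y) + (f x - f y) * g y := by ring
  rw [e]
  refine (abs_add_le _ _).trans ?_
  rw [abs_mul, abs_mul]
  push_cast
  have h3 := mul_le_mul (hA x) h2 (abs_nonneg _) A.coe_nonneg
  have h4 := mul_le_mul h1 (hB y) (abs_nonneg _) (by positivity)
  linarith

section Triangulation

variable {G : Set Plane} (T : Triangulation G)

theorem Triangulation.isCompact_triangle (j : Fin T.card) : IsCompact (T.triangle j) :=
  (Set.finite_range _).isCompact_convexHull ℝ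

theorem Triangulation.isCompact_closure {G : Set Plane} (T : Triangulation G) : IsCompact (closure G) := by
  rw [← T.cover]
  exact isCompact_iUnion T.isCompact_triangle

theorem Triangulation.mem_triangle_of_mem {x : Plane} (hx : x ∈ G) : ∃ j, x ∈ T.triangle j := by
  have := subset_closure hx
  rw [← T.cover] at this
  exact Set.mem_iUnion.1 this

theorem Triangulation.nonempty_interior (j : Fin T.card) : (interior (T.triangle j)).Nonempty := by
  rw [Triangulation.triangle, interior_convexHull_nonempty_iff_affineSpan_eq_top]
  refine (T.nondegenerate j).affineSpan_eq_top_iff_card_eq_finrank_add_one.2 ?_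
  simp

variable {T}

/-- The triangles and the complement of `G` form a finite closed cover, and on each piece the
function is affine or zero. No conformity of the mesh enters. -/
theorem lipschitz_of_mem_spaceP1 (hG : IsOpen G) {ξ : Plane → ℝ} (hξ : ξ ∈ spaceP1 T) :
    ∃ K, LipschitzWith K ξ := by
  obtain ⟨hc, h0, ha⟩ := hξ
  choose a ha using ha
  let L : Fin T.card → Plane →L[ℝ] ℝ := fun j => LinearMap.toContinuousLinearMap (a j).linear
  refine ⟨∑ j, ‖L j‖₊, lipschitzWith_of_finite_closed_cover (ι := Option (Fin T.card)) hc
    (F := fun o => o.elim Gᶜ T.triangle) ?_ ?_ ?_⟩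
  · rintro (_ | j)
    exacts [hG.isClosed_compl, (T.isCompact_triangle j).isClosed]
  · intro x
    by_cases hx : x ∈ G
    · obtain ⟨j, hj⟩ := T.mem_triangle_of_mem hx
      exact ⟨some j, hj⟩
    · exact ⟨none, hx⟩
  · rintro (_ | j)
    · refine LipschitzOnWith.of_dist_le_mul fun x hx y hy => ?_
      rw [h0 x hx, h0 y hy, dist_self]
      positivity
    · refine LipschitzOnWith.of_dist_le_mul fun x hx y hy => ?_
      rw [ha j x hx, ha j y hy, dist_eq_norm, dist_eq_norm]
      have e : a j x - a j y = L j (x - y) := by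
        have := (a j).linearMap_vsub x y
        simpa [L] using this.symm
      rw [e]
      refine ((L j).le_opNorm _).trans (mul_le_mul_of_nonneg_right ?_ (norm_nonneg _))
      have : ‖L j‖₊ ≤ ∑ j, ‖L j‖₊ :=
        Finset.single_le_sum (f := fun j => ‖L j‖₊) (fun _ _ => zero_le) (Finset.mem_univ j)
      exact_mod_cast this

theorem eq_zero_of_mem_spaceP1 {ξ : Plane → ℝ} (hξ : ξ ∈ spaceP1 T)
    (h : ∀ j i, ξ (T.vertex j i) = 0) : ξ = 0 := by
  obtain ⟨-, h0, ha⟩ := hξ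
  ext x
  by_cases hx : x ∈ G
  · obtain ⟨j, hj⟩ := T.mem_triangle_of_mem hx
    obtain ⟨a, ha⟩ := ha j
    have hsub : T.triangle j ⊆ a ⁻¹' {0} := by
      refine convexHull_min ?_ ((convex_singleton (0 : ℝ)).affine_preimage a)
      rintro _ ⟨i, rfl⟩
      have : T.vertex j i ∈ T.triangle j := subset_convexHull ℝ _ ⟨i, rfl⟩
      rw [Set.mem_preimage, Set.mem_singleton_iff, ← ha _ this, h j i]
    rw [ha x hj]
    exact hsub hj
  · exact h0 x hx

/-- Evaluation at all vertices is injective, since an affine function on a triangle is determined by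
its vertex values. -/
instance finiteDimensional_spaceP1 : FiniteDimensional ℝ (spaceP1 T) := by
  let ev : spaceP1 T →ₗ[ℝ] (Fin T.card × Fin 3 → ℝ) :=
    { toFun := fun ξ p => (ξ : Plane → ℝ) (T.vertex p.1 p.2)
      map_add' := fun _ _ => rfl
      map_smul' := fun _ _ => rfl }
  refine FiniteDimensional.of_injective ev ?_
  rw [← LinearMap.ker_eq_bot, LinearMap.ker_eq_bot']
  intro ξ hξ
  exact Subtype.ext (eq_zero_of_mem_spaceP1 ξ.2 fun j i => congrFun hξ (j, i))

end Triangulation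

section Hat

variable {dt : ℝ}

theorem hat_lipschitz (hdt : 0 < dt) (m : ℕ) : LipschitzWith (dt⁻¹).toNNReal (hat dt m) := by
  refine LipschitzWith.of_dist_le_mul fun s t => ?_
  rw [Real.dist_eq, Real.dist_eq, Real.coe_toNNReal _ (inv_nonneg.2 hdt.le), hat, hat,
    max_comm 0, max_comm 0]
  refine (abs_max_sub_max_le_abs _ _ _).trans ?_
  rw [sub_sub_sub_cancel_left]
  refine (abs_abs_sub_abs_le _ _).trans (le_of_eq ?_)
  rw [sub_sub_sub_cancel_right, ← sub_div, abs_div, abs_of_pos hdt, abs_sub_comm, div_eq_inv_mul]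

theorem hat_eq_zero_of_nonpos (hdt : 0 < dt) (m : ℕ) {t : ℝ} (ht : t ≤ 0) : hat dt m t = 0 := by
  have h1 : t / dt ≤ 0 := div_nonpos_of_nonpos_of_nonneg ht hdt.le
  refine max_eq_left ?_
  have := neg_abs_le (t / dt - (m + 1))
  have hm : (0 : ℝ) ≤ m := m.cast_nonneg
  linarith

theorem hat_eq_zero_of_ge (hdt : 0 < dt) (m : ℕ) {t : ℝ} (ht : (m + 2) * dt ≤ t) : hat dt m t = 0 := by
  have h1 : (m + 2 : ℝ) ≤ t / dt := by rwa [le_div_iff₀ hdt]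
  refine max_eq_left ?_
  have := le_abs_self (t / dt - (m + 1))
  linarith

end Hat

theorem abs_hat_le_one (dt : ℝ) (m : ℕ) (t : ℝ) : |hat dt m t| ≤ 1 := by
  rw [abs_of_nonneg (le_max_left _ _)]
  exact max_le zero_le_one (by linarith [abs_nonneg (t / dt - (m + 1))])

/-- The factor `exp (-σ t)` is not Lipschitz on the whole line, but the hat vanishes for `t ≤ 0`.
There `t` may be replaced by `max t 0`, and the new factor is bounded by one and `σ`-Lipschitz. -/
theorem damped_hat_lipschitz {σ dt : ℝ} (hσ : 0 < σ) (hdt : 0 < dt) (m : ℕ) :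
    ∃ K, LipschitzWith K (fun t => Real.exp (-σ * t) * hat dt m t) := by
  have h1 : LipschitzWith σ.toNNReal (fun t : ℝ => Real.exp (-σ * max t 0)) := by
    refine LipschitzWith.of_dist_le_mul fun s t => ?_
    rw [Real.coe_toNNReal _ hσ.le]
    wlog hst : s ≤ t generalizing s t
    · rw [dist_comm, dist_comm s]
      exact this t s (le_of_not_ge hst)
    have hle : max s 0 ≤ max t 0 := max_le_max hst le_rfl
    have hm := abs_max_sub_max_le_abs s t 0
    have e1 : Real.exp (-σ * max t 0) ≤ Real.exp (-σ * max s 0) :=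
      Real.exp_le_exp.2 (by nlinarith)
    have e2 : Real.exp (-σ * max s 0) ≤ 1 := by
      rw [Real.exp_le_one_iff]
      nlinarith [le_max_right s 0]
    have e3 : Real.exp (-σ * max t 0)
        = Real.exp (-σ * max s 0) * Real.exp (-(σ * (max t 0 - max s 0))) := by
      rw [← Real.exp_add]; congr 1; ring
    have e4 := Real.add_one_le_exp (-(σ * (max t 0 - max s 0)))
    rw [Real.dist_eq, Real.dist_eq, abs_of_nonneg (sub_nonneg.2 e1), e3]
    rw [abs_sub_comm, abs_of_nonneg (sub_nonneg.2 hle), abs_sub_comm,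
      abs_of_nonneg (sub_nonneg.2 hst)] at hm
    have e5 := Real.exp_pos (-σ * max s 0)
    have e6 : 0 ≤ σ * (max t 0 - max s 0) := mul_nonneg hσ.le (sub_nonneg.2 hle)
    rw [abs_sub_comm, abs_of_nonneg (sub_nonneg.2 hst)]
    nlinarith
  have h2 := lipschitzWith_mul_of_bounded h1 (hat_lipschitz hdt m) (A := 1) (B := 1)
    (fun t => by
      rw [Real.abs_exp, NNReal.coe_one, Real.exp_le_one_iff]
      nlinarith [le_max_right t 0])
    (fun t => by simpa using abs_hat_le_one dt m t)
  have e : (fun t => Real.exp (-σ * t) * hat dt m t) =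
      fun t => Real.exp (-σ * max t 0) * hat dt m t := by
    ext t
    rcases le_total t 0 with ht | ht
    · rw [hat_eq_zero_of_nonpos hdt m ht, mul_zero, mul_zero]
    · rw [max_eq_left ht]
  rw [e]
  exact ⟨_, h2⟩

theorem norm_sq_eq_time_pos (z : SpaceTime) : ‖z‖ ^ 2 = time z ^ 2 + ‖pos z‖ ^ 2 := by
  rw [pos_sq, EuclideanSpace.norm_sq_eq, Fin.sum_univ_three, time]
  simp only [Real.norm_eq_abs, sq_abs]
  ring

theorem time_sub (z z' : SpaceTime) : time (z - z') = time z - time z' := rfl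

theorem pos_sub (z z' : SpaceTime) : pos (z - z') = pos z - pos z' := by
  ext i; fin_cases i <;> rfl

theorem lipschitz_time : LipschitzWith 1 time := by
  refine LipschitzWith.of_dist_le_mul fun z z' => ?_
  rw [NNReal.coe_one, one_mul, Real.dist_eq, dist_eq_norm, ← time_sub]
  refine abs_le_of_sq_le_sq ?_ (norm_nonneg _)
  rw [norm_sq_eq_time_pos]
  nlinarith [sq_nonneg ‖pos (z - z')‖]

theorem lipschitz_pos : LipschitzWith 1 pos := by
  refine LipschitzWith.of_dist_le_mul fun z z' => ?_
  rw [NNReal.coe_one, one_mul, dist_eq_norm, dist_eq_norm, ← pos_sub]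
  refine (abs_le_of_sq_le_sq' ?_ (norm_nonneg _)).2
  rw [norm_sq_eq_time_pos]
  nlinarith [sq_nonneg (time (z - z'))]

theorem norm_le_of_time_pos {z : SpaceTime} {a b : ℝ} (ha : |time z| ≤ a) (hb : ‖pos z‖ ≤ b) :
    ‖z‖ ≤ a + b := by
  have ha0 := (abs_nonneg _).trans ha
  have hb0 := (norm_nonneg _).trans hb
  refine (abs_le_of_sq_le_sq' ?_ (add_nonneg ha0 hb0)).2
  rw [norm_sq_eq_time_pos, ← sq_abs (time z)]
  have := pow_le_pow_left₀ (abs_nonneg _) ha 2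
  have := pow_le_pow_left₀ (norm_nonneg _) hb 2
  nlinarith [mul_nonneg ha0 hb0]

/-- Functions whose damping is Lipschitz with compact support, and that vanish outside
`[0, ∞) × closure G`. -/
structure IsNiceDisplacement (σ : ℝ) (G : Set Plane) (u : SpaceTime → ℝ) : Prop where
  lipschitz : ∃ K, LipschitzWith K (fun z => Real.exp (-σ * time z) * u z)
  compact : HasCompactSupport (fun z => Real.exp (-σ * time z) * u z)
  support : ∀ z, ¬ (0 ≤ time z ∧ pos z ∈ closure G) → u z = 0

theorem IsNiceDisplacement.continuous {σ : ℝ} {G : Set Plane} {u : SpaceTime → ℝ}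
    (h : IsNiceDisplacement σ G u) : Continuous u := by
  obtain ⟨K, hK⟩ := h.lipschitz
  have ht := continuous_time
  have : u = fun z => Real.exp (σ * time z) * (Real.exp (-σ * time z) * u z) := by
    ext z
    rw [← mul_assoc, ← Real.exp_add]
    simp
  rw [this]
  exact Continuous.mul (by fun_prop) hK.continuous

theorem IsNiceDisplacement.finiteTraceNorm {σ : ℝ} {G : Set Plane} {u : SpaceTime → ℝ}
    (h : IsNiceDisplacement σ G u) : FiniteTraceNorm σ u :=
  let ⟨_, hK⟩ := h.lipschitz
  finiteTraceNorm_of_lipschitz hK h.compact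

theorem IsNiceDisplacement.memTraceSpace {σ : ℝ} {G : Set Plane} {u : SpaceTime → ℝ}
    (h : IsNiceDisplacement σ G u) : MemTraceSpace σ G u :=
  ⟨h.finiteTraceNorm.memLp, Eventually.of_forall h.support, by
    simpa only [weight_zero_half] using h.finiteTraceNorm.finite⟩

theorem isNiceDisplacement_hat_mul {σ : ℝ} (hσ : 0 < σ) {G : Set Plane} (hG : IsOpen G)
    (M : Mesh G) (m : ℕ) {ξ : Plane → ℝ} (hξ : ξ ∈ spaceP1 M.tri) :
    IsNiceDisplacement σ G (fun z => hat M.dt m (time z) * ξ (pos z)) := by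
  have hsupp : ∀ x, x ∉ closure G → ξ x = 0 := fun x hx => hξ.2.1 x fun h => hx (subset_closure h)
  obtain ⟨R, hR⟩ := M.tri.isCompact_closure.isBounded.exists_norm_le
  have hcs : HasCompactSupport ξ := HasCompactSupport.intro M.tri.isCompact_closure hsupp
  obtain ⟨B, hB⟩ := hcs.exists_bound_of_continuous hξ.1
  obtain ⟨K, hK⟩ := damped_hat_lipschitz hσ M.dt_pos m
  obtain ⟨K', hK'⟩ := lipschitz_of_mem_spaceP1 hG hξ
  have hbt : ∀ t, |Real.exp (-σ * t) * hat M.dt m t| ≤ 1 := fun t => by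
    rcases le_total t 0 with ht | ht
    · rw [hat_eq_zero_of_nonpos M.dt_pos m ht]; simp
    · rw [abs_mul, Real.abs_exp]
      refine mul_le_one₀ ?_ (abs_nonneg _) (abs_hat_le_one _ _ _)
      rw [Real.exp_le_one_iff]
      nlinarith
  have hlip := lipschitzWith_mul_of_bounded (hK.comp lipschitz_time) (hK'.comp lipschitz_pos)
    (A := 1) (B := B.toNNReal) (fun z => by simpa using hbt (time z))
    (fun z => (hB (pos z)).trans (Real.le_coe_toNNReal B))
  have e : (fun z => Real.exp (-σ * time z) * (hat M.dt m (time z) * ξ (pos z))) = fun z =>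
      ((fun t => Real.exp (-σ * t) * hat M.dt m t) ∘ time) z * (ξ ∘ pos) z := by
    ext z
    simp only [Function.comp_apply]; ring
  refine ⟨⟨_, by rw [e]; exact hlip⟩, ?_, ?_⟩
  -- The hat lives on times in `[0, (m + 2) Δt]`, and `R` bounds the closure of `G`.
  · refine HasCompactSupport.intro (isCompact_closedBall (0 : SpaceTime) ((m + 2) * M.dt + R))
      fun z hz => ?_
    by_contra hne
    have h1 : hat M.dt m (time z) ≠ 0 := fun h => hne (by rw [h]; simp)
    have h2 : ξ (pos z) ≠ 0 := fun h => hne (by rw [h]; simp)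
    refine hz (mem_closedBall_zero_iff.2 (norm_le_of_time_pos ?_ (hR _ ?_)))
    · have h3 : 0 < time z := by
        by_contra! h
        exact h1 (hat_eq_zero_of_nonpos M.dt_pos m h)
      rw [abs_of_pos h3]
      by_contra! h
      exact h1 (hat_eq_zero_of_ge M.dt_pos m h.le)
    · by_contra h
      exact h2 (hsupp _ h)
  · intro z hz
    by_cases ht : 0 ≤ time z
    · rw [hsupp _ fun h => hz ⟨ht, h⟩, mul_zero]
    · rw [hat_eq_zero_of_nonpos M.dt_pos m (le_of_not_ge ht), zero_mul]

theorem isNiceDisplacement_of_mem {σ : ℝ} (hσ : 0 < σ) {G : Set Plane} (hG : IsOpen G)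
    {M : Mesh G} {u : SpaceTime → ℝ} (hu : u ∈ dispSpace M) : IsNiceDisplacement σ G u := by
  induction hu using Submodule.span_induction with
  | mem u hu =>
    obtain ⟨m, ξ, hξ, rfl⟩ := hu
    exact isNiceDisplacement_hat_mul hσ hG M m hξ
  | zero =>
    have e : (fun z => Real.exp (-σ * time z) * (0 : SpaceTime → ℝ) z) = 0 := by ext z; simp
    exact ⟨⟨0, by rw [e]; exact LipschitzWith.const (0 : ℝ)⟩, by rw [e]; exact HasCompactSupport.zero, fun _ _ => rfl⟩
  | add u v _ _ hu hv =>
    obtain ⟨⟨K, hK⟩, h2, h3⟩ := hu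
    obtain ⟨⟨L, hL⟩, k2, k3⟩ := hv
    have e : (fun z => Real.exp (-σ * time z) * (u + v) z) =
        (fun z => Real.exp (-σ * time z) * u z) + fun z => Real.exp (-σ * time z) * v z := by
      ext z; simp only [Pi.add_apply]; ring
    exact ⟨⟨K + L, by rw [e]; exact hK.add hL⟩, by rw [e]; exact h2.add k2, fun z hz => by
      rw [Pi.add_apply, h3 z hz, k3 z hz, add_zero]⟩
  | smul c u _ hu =>
    obtain ⟨⟨K, hK⟩, h2, h3⟩ := hu
    have e : (fun z => Real.exp (-σ * time z) * (c • u) z) =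
        (fun _ => c) * fun z => Real.exp (-σ * time z) * u z := by
      ext z; simp only [Pi.mul_apply, Pi.smul_apply, smul_eq_mul]; ring
    exact ⟨⟨‖c‖₊ * K, by rw [e]; exact (lipschitzWith_smul c).comp hK⟩, by rw [e]; exact h2.mul_left, fun z hz => by
      rw [Pi.smul_apply, h3 z hz, smul_zero]⟩

/-- The space lies in a finite supremum, over the time nodes, of linear images of the
finite-dimensional space in `x`. -/
instance finiteDimensional_dispSpace {G : Set Plane} (M : Mesh G) :
    FiniteDimensional ℝ (dispSpace M) := by
  let L : Fin M.steps → (Plane → ℝ) →ₗ[ℝ] (SpaceTime → ℝ) := fun m =>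
    { toFun := fun ξ z => hat M.dt m (time z) * ξ (pos z)
      map_add' := fun ξ ζ => by ext z; simp [mul_add]
      map_smul' := fun c ξ => by ext z; simp; ring }
  have hle : dispSpace M ≤ ⨆ m, (spaceP1 M.tri).map (L m) := by
    refine Submodule.span_le.2 ?_
    rintro u ⟨m, ξ, hξ, rfl⟩
    exact Submodule.mem_iSup_of_mem m ⟨ξ, hξ, rfl⟩
  exact Submodule.finiteDimensional_of_le hle

/-! ### The multiplier space -/

section Multiplier

variable {G : Set Plane} (M : Mesh G)

theorem Mesh.measurableSet_cell (i : M.Index) : MeasurableSet (M.cell i) :=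
  (measurableSet_le measurable_const continuous_time.measurable).inter
    ((measurableSet_lt continuous_time.measurable measurable_const).inter
      (isOpen_interior.measurableSet.preimage continuous_pos.measurable))

theorem Mesh.cell_subset_closedBall (i : M.Index) : ∃ R, M.cell i ⊆ Metric.closedBall 0 R := by
  obtain ⟨R, hR⟩ := (M.tri.isCompact_triangle i.2).isBounded.exists_norm_le
  refine ⟨((i.1 : ℝ) + 1) * M.dt + R, fun z hz => ?_⟩
  obtain ⟨h1, h2, h3⟩ := hz
  have h0 : 0 ≤ time z := (mul_nonneg (Nat.cast_nonneg _) M.dt_pos.le).trans h1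
  exact mem_closedBall_zero_iff.2 (norm_le_of_time_pos (by rw [abs_of_nonneg h0]; exact h2.le)
    (hR _ (interior_subset h3)))

theorem Mesh.integrableOn_cell (i : M.Index) {f : SpaceTime → ℝ} (hf : Continuous f) :
    IntegrableOn f (M.cell i) := by
  obtain ⟨R, hR⟩ := M.cell_subset_closedBall i
  exact (hf.continuousOn.integrableOn_compact (isCompact_closedBall 0 R)).mono_set hR

/-- Opening the time interval gives a nonempty open subset, since nondegenerate triangles have
interior points. Hence the weighted means divide by a positive mass. -/
theorem Mesh.measure_cell_pos (i : M.Index) : 0 < (volume : Measure SpaceTime) (M.cell i) := by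
  set U : Set SpaceTime := {z | (i.1 : ℝ) * M.dt < time z ∧ time z < ((i.1 : ℝ) + 1) * M.dt ∧
    pos z ∈ interior (M.tri.triangle i.2)} with hU
  have hopen : IsOpen U :=
    (isOpen_lt continuous_const continuous_time).inter
      ((isOpen_lt continuous_time continuous_const).inter (isOpen_interior.preimage continuous_pos))
  obtain ⟨x, hx⟩ := M.tri.nonempty_interior i.2
  have hne : U.Nonempty := by
    refine ⟨!₂[((i.1 : ℝ) + 1 / 2) * M.dt, x 0, x 1], ?_, ?_, ?_⟩
    · have := M.dt_pos
      simp only [time, Matrix.cons_val_zero]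
      nlinarith
    · have := M.dt_pos
      simp only [time, Matrix.cons_val_zero]
      nlinarith
    · convert hx
      ext j
      fin_cases j <;> rfl
  exact (hopen.measure_pos _ hne).trans_le (measure_mono fun z hz => ⟨hz.1.le, hz.2⟩)

theorem Mesh.eq_of_mem_cell {i j : M.Index} {z : SpaceTime} (hi : z ∈ M.cell i)
    (hj : z ∈ M.cell j) : i = j := by
  obtain ⟨a1, a2, a3⟩ := hi
  obtain ⟨b1, b2, b3⟩ := hj
  have h1 : (i.1 : ℝ) < (j.1 : ℝ) + 1 := lt_of_mul_lt_mul_right (a1.trans_lt b2) M.dt_pos.le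
  have h2 : (j.1 : ℝ) < (i.1 : ℝ) + 1 := lt_of_mul_lt_mul_right (b1.trans_lt a2) M.dt_pos.le
  refine Prod.ext (Fin.ext ?_) ?_
  · have h1' : (i.1 : ℕ) < (j.1 : ℕ) + 1 := by exact_mod_cast h1
    have h2' : (j.1 : ℕ) < (i.1 : ℕ) + 1 := by exact_mod_cast h2
    omega
  · by_contra hne
    exact Set.disjoint_left.1 (M.tri.disjoint hne) a3 b3

theorem pwConst_eq_of_mem {y : M.Index → ℝ} {i : M.Index} {z : SpaceTime} (hz : z ∈ M.cell i) :
    pwConst M y z = y i := by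
  rw [pwConst, Finset.sum_eq_single i]
  · rw [Set.indicator_of_mem hz]; simp
  · intro j _ hj
    rw [Set.indicator_of_notMem fun h => hj (M.eq_of_mem_cell h hz), mul_zero]
  · simp

theorem pwConst_sub (y y' : M.Index → ℝ) (z : SpaceTime) :
    pwConst M (y - y') z = pwConst M y z - pwConst M y' z := by
  simp [pwConst, sub_mul, Finset.sum_sub_distrib]

/-- The weighted volume of a space-time element. -/
noncomputable def mass (σ : ℝ) (i : M.Index) : ℝ :=
  ∫ z in M.cell i, Real.exp (-2 * σ * time z)

variable (σ : ℝ)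

theorem continuous_exp_time : Continuous fun z => Real.exp (-2 * σ * time z) := by
  have := continuous_time
  fun_prop

theorem mass_pos (i : M.Index) : 0 < mass M σ i := by
  rw [mass, setIntegral_pos_iff_support_of_nonneg_ae
    (Eventually.of_forall fun z => (Real.exp_pos _).le)
    (M.integrableOn_cell i (continuous_exp_time σ))]
  have : (Function.support fun z => Real.exp (-2 * σ * time z)) = Set.univ :=
    Set.eq_univ_of_forall fun z => (Real.exp_pos _).ne'
  rw [this, Set.univ_inter]
  exact M.measure_cell_pos i

theorem mass_mul_coeff (u : SpaceTime → ℝ) (i : M.Index) :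
    mass M σ i * coeff M σ u i = ∫ z in M.cell i, Real.exp (-2 * σ * time z) * u z :=
  mul_div_cancel₀ _ (mass_pos M σ i).ne'

/-- Integrability of `e^{-2σt} u` on the space-time elements. -/
def CellIntegrable (u : SpaceTime → ℝ) : Prop :=
  ∀ i, IntegrableOn (fun z => Real.exp (-2 * σ * time z) * u z) (M.cell i)

theorem cellIntegrable_of_continuous {u : SpaceTime → ℝ} (hu : Continuous u) :
    CellIntegrable M σ u := fun i => M.integrableOn_cell i ((continuous_exp_time σ).mul hu)

theorem cellIntegrable_pwConst (y : M.Index → ℝ) : CellIntegrable M σ (pwConst M y) := fun i =>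
  IntegrableOn.congr_fun (f := fun z => Real.exp (-2 * σ * time z) * y i)
    ((M.integrableOn_cell i (continuous_exp_time σ)).mul_const (y i))
    (fun z hz => by simp only [pwConst_eq_of_mem M hz]) (M.measurableSet_cell i)

theorem coeff_pwConst (y : M.Index → ℝ) : coeff M σ (pwConst M y) = y := by
  ext i
  refine mul_left_cancel₀ (mass_pos M σ i).ne' ?_
  rw [mass_mul_coeff, mass, ← integral_mul_const]
  exact setIntegral_congr_fun (M.measurableSet_cell i)
    fun z hz => by simp only [pwConst_eq_of_mem M hz]

theorem exp_mul_pwConst_mul (y : M.Index → ℝ) (u : SpaceTime → ℝ) :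
    (fun z => Real.exp (-2 * σ * time z) * (pwConst M y z * u z)) = fun z => ∑ i,
      y i * (M.cell i).indicator (fun z => Real.exp (-2 * σ * time z) * u z) z := by
  ext z
  rw [pwConst, Finset.sum_mul, Finset.mul_sum]
  refine Finset.sum_congr rfl fun i _ => ?_
  by_cases hz : z ∈ M.cell i
  · rw [Set.indicator_of_mem hz, Set.indicator_of_mem hz]
    simp only [Pi.one_apply]; ring
  · rw [Set.indicator_of_notMem hz, Set.indicator_of_notMem hz]
    ring

variable {σ}

theorem CellIntegrable.integrable_pwConst_mul {u : SpaceTime → ℝ} (hu : CellIntegrable M σ u)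
    (y : M.Index → ℝ) :
    Integrable fun z => Real.exp (-2 * σ * time z) * (pwConst M y z * u z) := by
  rw [exp_mul_pwConst_mul]
  exact integrable_finsetSum _ fun i _ =>
    ((integrable_indicator_iff (M.measurableSet_cell i)).2 (hu i)).const_mul _

theorem CellIntegrable.innerS_pwConst {u : SpaceTime → ℝ} (hu : CellIntegrable M σ u)
    (y : M.Index → ℝ) :
    innerS σ (pwConst M y) u = ∑ i, mass M σ i * y i * coeff M σ u i := by
  rw [innerS, exp_mul_pwConst_mul, integral_finsetSum _ fun i _ =>
    ((integrable_indicator_iff (M.measurableSet_cell i)).2 (hu i)).const_mul _]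
  refine Finset.sum_congr rfl fun i _ => ?_
  rw [integral_const_mul, integral_indicator (M.measurableSet_cell i), ← mass_mul_coeff]
  ring

theorem innerS_comm (u v : SpaceTime → ℝ) : innerS σ u v = innerS σ v u := by
  simp only [innerS, mul_comm (u _)]

theorem innerS_pwConst_self (y : M.Index → ℝ) :
    innerS σ (pwConst M y) (pwConst M y) = ∑ i, mass M σ i * y i ^ 2 := by
  rw [(cellIntegrable_pwConst M σ y).innerS_pwConst M, coeff_pwConst]
  exact Finset.sum_congr rfl fun i _ => by ring

theorem CellIntegrable.coeff_add {u v : SpaceTime → ℝ} (hu : CellIntegrable M σ u)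
    (hv : CellIntegrable M σ v) : coeff M σ (u + v) = coeff M σ u + coeff M σ v := by
  ext i
  simp only [coeff, Pi.add_apply, mul_add]
  rw [integral_add (hu i) (hv i), add_div]

theorem coeff_smul (c : ℝ) (u : SpaceTime → ℝ) : coeff M σ (c • u) = c • coeff M σ u := by
  ext i
  simp only [coeff, Pi.smul_apply, smul_eq_mul]
  rw [← mul_div_assoc, ← integral_const_mul]
  congr 2
  ext z
  ring

/-- Bessel's inequality for the projection to the multiplier space. -/
theorem CellIntegrable.bessel {u : SpaceTime → ℝ} (hu : CellIntegrable M σ u)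
    (hi : Integrable fun z => Real.exp (-2 * σ * time z) * (u z * u z)) :
    ∑ i, mass M σ i * coeff M σ u i ^ 2 ≤ innerS σ u u := by
  set x := coeff M σ u with hx
  have h1 : innerS σ (pwConst M x) u = ∑ i, mass M σ i * x i ^ 2 := by
    rw [hu.innerS_pwConst M]
    exact Finset.sum_congr rfl fun i _ => by ring
  have h2 := innerS_pwConst_self (σ := σ) M x
  -- The integrated form of `2pu - p² ≤ u²`, where `p` is the projection of `u`.
  have h3 : 2 * innerS σ (pwConst M x) u - innerS σ (pwConst M x) (pwConst M x) ≤ innerS σ u u := by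
    have i1 := (hu.integrable_pwConst_mul M x).const_mul 2
    have i2 := (cellIntegrable_pwConst M σ x).integrable_pwConst_mul M x
    rw [innerS, innerS, innerS, ← integral_const_mul, ← integral_sub i1 i2]
    refine integral_mono (i1.sub i2) hi fun z => ?_
    dsimp only
    nlinarith [mul_nonneg (Real.exp_pos (-2 * σ * time z)).le (sq_nonneg (pwConst M x z - u z))]
  linarith

end Multiplier

/-! ### The displacement space as a subspace of `L²` -/

section Embedding

variable {σ : ℝ} {G : Set Plane}

theorem exp_neg_two_mul (σ t a b : ℝ) :
    Real.exp (-σ * t) * a * (Real.exp (-σ * t) * b) = Real.exp (-2 * σ * t) * (a * b) := by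
  have : Real.exp (-2 * σ * t) = Real.exp (-σ * t) * Real.exp (-σ * t) := by
    rw [← Real.exp_add]; congr 1; ring
  rw [this]; ring

theorem IsNiceDisplacement.memLp {u : SpaceTime → ℝ} (h : IsNiceDisplacement σ G u) :
    MemLp (fun z => Real.exp (-σ * time z) * u z) 2 (volume : Measure SpaceTime) :=
  let ⟨_, hK⟩ := h.lipschitz
  hK.continuous.memLp_of_hasCompactSupport h.compact

theorem IsNiceDisplacement.integrable_sq {u : SpaceTime → ℝ} (h : IsNiceDisplacement σ G u) :
    Integrable fun z => Real.exp (-2 * σ * time z) * (u z * u z) := by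
  refine h.memLp.integrable_sq.congr (Eventually.of_forall fun z => ?_)
  dsimp only
  rw [sq, exp_neg_two_mul]

variable (hσ : 0 < σ) (hG : IsOpen G) (M : Mesh G)

/-- The embedding `u ↦ e^{-σt} u` of the displacement space into `L²`. -/
noncomputable def dispToLp : dispSpace M →ₗ[ℝ] Lp ℝ 2 (volume : Measure SpaceTime) where
  toFun u := (isNiceDisplacement_of_mem hσ hG u.2).memLp.toLp _
  map_add' u v := by
    rw [← MemLp.toLp_add]
    exact MemLp.toLp_congr _ _ (Eventually.of_forall fun z => by simp [mul_add])
  map_smul' c u := by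
    rw [RingHom.id_apply, ← MemLp.toLp_const_smul]
    exact MemLp.toLp_congr _ _ (Eventually.of_forall fun z => by simp [mul_left_comm])

theorem norm_dispToLp_sq (u : dispSpace M) : ‖dispToLp hσ hG M u‖ ^ 2 = innerS σ u u := by
  rw [← integral_norm_sq_eq, innerS]
  refine integral_congr_ae
    ((isNiceDisplacement_of_mem hσ hG u.2).memLp.coeFn_toLp.mono fun z hz => ?_)
  dsimp only
  rw [dispToLp]
  simp only [LinearMap.coe_mk, AddHom.coe_mk]
  rw [hz, Real.norm_eq_abs, sq_abs, sq, exp_neg_two_mul]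

/-- Displacements are continuous, so equality almost everywhere is equality. Thus the `L²` norm is a
norm on genuine functions. -/
theorem dispToLp_injective : Function.Injective (dispToLp hσ hG M) := by
  rw [← LinearMap.ker_eq_bot, LinearMap.ker_eq_bot']
  intro u hu
  have hn := isNiceDisplacement_of_mem hσ hG u.2
  have h1 : (fun z => Real.exp (-σ * time z) * (u : SpaceTime → ℝ) z) =ᵐ[volume] fun _ => 0 := by
    have := hn.memLp.coeFn_toLp
    have hu' : hn.memLp.toLp _ = 0 := hu
    rw [hu'] at this
    exact this.symm.trans (Lp.coeFn_zero _ _ _)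
  obtain ⟨K, hK⟩ := hn.lipschitz
  have h2 := (hK.continuous.ae_eq_iff_eq volume continuous_const).1 h1
  ext z
  have h3 := congrFun h2 z
  simpa [(Real.exp_pos _).ne'] using h3

/-- The displacement space with the norm `‖·‖_{0,0,σ}`. -/
noncomputable abbrev DispLp : Submodule ℝ (Lp ℝ 2 (volume : Measure SpaceTime)) :=
  LinearMap.range (dispToLp hσ hG M)

/-- The displacement space is isomorphic to its image in `L²`. -/
noncomputable def dispEquiv : dispSpace M ≃ₗ[ℝ] DispLp hσ hG M :=
  LinearEquiv.ofInjective _ (dispToLp_injective hσ hG M)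

theorem norm_dispEquiv_sq (u : dispSpace M) : ‖dispEquiv hσ hG M u‖ ^ 2 = innerS σ u u :=
  norm_dispToLp_sq hσ hG M u

theorem norm_dispEquiv_sub (u v : dispSpace M) :
    ‖dispEquiv hσ hG M u - dispEquiv hσ hG M v‖
      = normS σ (fun z => (u : SpaceTime → ℝ) z - (v : SpaceTime → ℝ) z) := by
  rw [normS, ← map_sub, ← Real.sqrt_sq (norm_nonneg (dispEquiv hσ hG M (u - v))),
    norm_dispEquiv_sq]
  rfl

end Embedding

/-! ### The discrete contact problem as an abstract mixed problem -/

section Assembly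

variable {σ μ : ℝ} {G : Set Plane} (hσ : 0 < σ) (hG : IsOpen G) (M₁ M₂ : Mesh G)
  {g : SpaceTime → ℂ} (hg : IsForceTransform σ g)

theorem finiteTraceNorm_coe (hσ : 0 < σ) (hG : IsOpen G) {M : Mesh G} (u : dispSpace M) :
    FiniteTraceNorm σ (u : SpaceTime → ℝ) :=
  (isNiceDisplacement_of_mem hσ hG u.2).finiteTraceNorm

theorem cellIntegrable_coe (hσ : 0 < σ) (hG : IsOpen G) {M : Mesh G} (M₂ : Mesh G)
    (u : dispSpace M) : CellIntegrable M₂ σ (u : SpaceTime → ℝ) :=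
  cellIntegrable_of_continuous M₂ σ (isNiceDisplacement_of_mem hσ hG u.2).continuous

/-- The form `Re ⟨𝒮_σ u, v⟩_σ` on the displacement space. -/
noncomputable def dtnBilin (μ : ℝ) : dispSpace M₁ →ₗ[ℝ] dispSpace M₁ →ₗ[ℝ] ℝ :=
  LinearMap.mk₂ ℝ (fun u v => dtnForm σ μ u v)
    (fun u u' v => dtnForm_add_left (finiteTraceNorm_coe hσ hG u) (finiteTraceNorm_coe hσ hG u')
      (finiteTraceNorm_coe hσ hG v))
    (fun c u _ => dtnForm_smul_left c (finiteTraceNorm_coe hσ hG u))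
    (fun u v v' => re_pairing_add (finiteTraceNorm_coe hσ hG v).memLp
      (finiteTraceNorm_coe hσ hG v').memLp
      ((finiteTraceNorm_coe hσ hG u).integrable_dtn (finiteTraceNorm_coe hσ hG v))
      ((finiteTraceNorm_coe hσ hG u).integrable_dtn (finiteTraceNorm_coe hσ hG v')))
    (fun c _ v => re_pairing_smul c (finiteTraceNorm_coe hσ hG v).memLp)

/-- The load on the displacement space. -/
noncomputable def loadLin : dispSpace M₁ →ₗ[ℝ] ℝ where
  toFun v := (pairing σ g v).re
  map_add' u v := re_pairing_add (finiteTraceNorm_coe hσ hG u).memLp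
    (finiteTraceNorm_coe hσ hG v).memLp ((finiteTraceNorm_coe hσ hG u).integrable_force hσ hg)
      ((finiteTraceNorm_coe hσ hG v).integrable_force hσ hg)
  map_smul' c v := re_pairing_smul c (finiteTraceNorm_coe hσ hG v).memLp

/-- The coefficients of the projection to the multiplier space. -/
noncomputable def coeffLin : dispSpace M₁ →ₗ[ℝ] M₂.Index → ℝ where
  toFun v := coeff M₂ σ v
  map_add' u v := (cellIntegrable_coe hσ hG M₂ u).coeff_add M₂ (cellIntegrable_coe hσ hG M₂ v)
  map_smul' c v := coeff_smul M₂ c v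

/-- The discrete mixed problem as a mixed problem in finite dimension. -/
noncomputable def mixedData {C : ℝ} (hC : IsCoercivityConstant σ μ G C) :
    MixedData (DispLp hσ hG M₁) M₂.Index :=
  MixedData.ofEquiv (dispEquiv hσ hG M₁) (dtnBilin hσ hG M₁ μ) (loadLin hσ hG M₁ hg)
    (coeffLin hσ hG M₁ M₂) (mass M₂ σ) C hC.1
    (fun v => (norm_dispEquiv_sq hσ hG M₁ v).symm ▸
      (mul_le_mul_of_nonneg_left ((finiteTraceNorm_coe hσ hG v).innerS_le hσ) hC.1.le).trans
        (hC.2 _ (isNiceDisplacement_of_mem hσ hG v.2).memTraceSpace))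
    (mass_pos M₂ σ)
    (fun v => (norm_dispEquiv_sq hσ hG M₁ v).symm ▸ (cellIntegrable_coe hσ hG M₂ v).bessel M₂
      (isNiceDisplacement_of_mem hσ hG v.2).integrable_sq)

variable {C : ℝ} (hC : IsCoercivityConstant σ μ G C)

theorem mixedData_a (u v : dispSpace M₁) :
    (mixedData hσ hG M₁ M₂ hg hC).a (dispEquiv hσ hG M₁ u) (dispEquiv hσ hG M₁ v) =
      (pairing σ (dtnTransform σ μ u) v).re :=
  MixedData.ofEquiv_a ..

theorem mixedData_ℓ (v : dispSpace M₁) :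
    (mixedData hσ hG M₁ M₂ hg hC).ℓ (dispEquiv hσ hG M₁ v) = (pairing σ g v).re :=
  MixedData.ofEquiv_ℓ ..

theorem mixedData_x (u : dispSpace M₁) :
    (mixedData hσ hG M₁ M₂ hg hC).x (dispEquiv hσ hG M₁ u) = coeff M₂ σ u :=
  MixedData.ofEquiv_x ..

theorem mixedData_pair (y : M₂.Index → ℝ) (u : dispSpace M₁) :
    (mixedData hσ hG M₁ M₂ hg hC).pair y (dispEquiv hσ hG M₁ u) = innerS σ (pwConst M₂ y) u := by
  rw [MixedData.pair, mixedData_x, (cellIntegrable_coe hσ hG M₂ u).innerS_pwConst M₂]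
  rfl

theorem mixedData_solves_iff (y : M₂.Index → ℝ) (u : dispSpace M₁) :
    (mixedData hσ hG M₁ M₂ hg hC).Solves y (dispEquiv hσ hG M₁ u) ↔
      SolvesDtN M₁ σ μ g (pwConst M₂ y) u := by
  have key : ∀ v : dispSpace M₁, ((mixedData hσ hG M₁ M₂ hg hC).a (dispEquiv hσ hG M₁ u)
      (dispEquiv hσ hG M₁ v) = (mixedData hσ hG M₁ M₂ hg hC).ℓ (dispEquiv hσ hG M₁ v) +
        (mixedData hσ hG M₁ M₂ hg hC).pair y (dispEquiv hσ hG M₁ v)) ↔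
      (pairing σ (dtnTransform σ μ u) v).re = (pairing σ g v).re + innerS σ (pwConst M₂ y) v := by
    intro v
    rw [mixedData_pair, mixedData_a, mixedData_ℓ]
  rw [MixedData.Solves, (dispEquiv hσ hG M₁).surjective.forall, forall_congr' key]
  exact ⟨fun h => ⟨u.2, fun v hv => h ⟨v, hv⟩⟩, fun h v => h.2 v v.2⟩

theorem mixedData_isSolution_iff (y : M₂.Index → ℝ) (u : dispSpace M₁) :
    (mixedData hσ hG M₁ M₂ hg hC).IsSolution (dispEquiv hσ hG M₁ u) y ↔
      IsMixedSolution M₁ M₂ σ μ g u y := by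
  have key : ∀ m : M₂.Index → ℝ, (mixedData hσ hG M₁ M₂ hg hC).pair (m - y) (dispEquiv hσ hG M₁ u)
      = innerS σ u (fun z => pwConst M₂ m z - pwConst M₂ y z) := fun m => by
    rw [mixedData_pair, innerS_comm]
    congr 1
    ext z
    exact pwConst_sub M₂ m y z
  constructor
  · intro h
    exact ⟨h.nonneg, (mixedData_solves_iff hσ hG M₁ M₂ hg hC y u).1 h.solves,
      fun m hm => key m ▸ h.inequality m hm⟩
  · intro h
    exact ⟨h.nonneg, (mixedData_solves_iff hσ hG M₁ M₂ hg hC y u).2 h.equation,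
      fun m hm => (key m).symm ▸ h.inequality m hm⟩

theorem normS_pwConst_sub (y y' : M₂.Index → ℝ) :
    normS σ (fun z => pwConst M₂ y z - pwConst M₂ y' z) =
      Real.sqrt ((mixedData hσ hG M₁ M₂ hg hC).sqNorm (y - y')) := by
  have : (fun z => pwConst M₂ y z - pwConst M₂ y' z) = pwConst M₂ (y - y') := by
    ext z
    exact (pwConst_sub M₂ y y' z).symm
  rw [this, normS, innerS_pwConst_self]
  rfl

/-- The linear problems of the Uzawa iteration have unique solutions. -/
theorem exists_dtn_solver (hσ : 0 < σ) (hG : IsOpen G) (hg : IsForceTransform σ g)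
    (hC : IsCoercivityConstant σ μ G C) :
    ∃ S : (M₂.Index → ℝ) → dispSpace M₁, ∀ y u,
      SolvesDtN M₁ σ μ g (pwConst M₂ y) u ↔ u = S y := by
  have h := fun y => (mixedData hσ hG M₁ M₂ hg hC).existsUnique_solves y
  choose s hs huniq using h
  refine ⟨fun y => (dispEquiv hσ hG M₁).symm (s y), fun y u => ⟨fun hu => ?_, ?_⟩⟩
  · have h1 := huniq y _ ((mixedData_solves_iff hσ hG M₁ M₂ hg hC y ⟨u, hu.1⟩).2 hu)
    change u = ((dispEquiv hσ hG M₁).symm (s y) : SpaceTime → ℝ)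
    rw [← h1, LinearEquiv.symm_apply_apply]
  · rintro rfl
    rw [← mixedData_solves_iff hσ hG M₁ M₂ hg hC, LinearEquiv.apply_symm_apply]
    exact hs y

end Assembly

end UzawaContact

open UzawaContact
theorem lemma8p1 (σ μ : ℝ) (hσ : 0 < σ) (hμ : 0 < μ) (G : Set Plane) (hG : IsOpen G)
    (M₁ M₂ : Mesh G) (g : SpaceTime → ℂ) (hg : IsForceTransform σ g) :
    (∃ C, IsCoercivityConstant σ μ G C) ∧
    ∀ C, IsCoercivityConstant σ μ G C → ∀ ρ : ℝ, 0 < ρ → ρ < 2 * C →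
      ∃ (u : ℕ → SpaceTime → ℝ) (y : ℕ → M₂.Index → ℝ),
        IsUzawa M₁ M₂ σ μ ρ g u y ∧
        (∀ u' y', IsUzawa M₁ M₂ σ μ ρ g u' y' → u' = u ∧ y' = y) ∧
        (∃ us ys, IsMixedSolution M₁ M₂ σ μ g us ys ∧
          Tendsto (fun k => normS σ (fun z => u k z - us z)) atTop (𝓝 0) ∧
          Tendsto (fun k => normS σ (fun z => pwConst M₂ (y k) z - pwConst M₂ ys z))
            atTop (𝓝 0)) ∧
        (∀ us ys, IsMixedSolution M₁ M₂ σ μ g us ys →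
          Antitone (fun k => normS σ (fun z => pwConst M₂ (y k) z - pwConst M₂ ys z)) ∧
          Tendsto (fun k => normS σ (fun z => u k z - us z)) atTop (𝓝 0)) := by
  refine ⟨⟨_, isCoercivityConstant hσ hμ G⟩, fun C hC ρ hρ hρC => ?_⟩
  obtain ⟨S, hS⟩ := exists_dtn_solver M₁ M₂ hσ hG hg hC
  -- Since each displacement iterate is determined by the current multiplier through `S`, the
  -- recursion runs on multipliers alone.
  let y : ℕ → M₂.Index → ℝ := fun k =>
    Nat.rec 0 (fun _ y i => max (y i - ρ * coeff M₂ σ (S y) i) 0) k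
  let D := mixedData hσ hG M₁ M₂ hg hC
  let e := dispEquiv hσ hG M₁
  have hsolve : ∀ k, SolvesDtN M₁ σ μ g (pwConst M₂ (y k)) (S (y k)) := fun k => (hS _ _).2 rfl
  have hDsolve : ∀ k, D.Solves (y k) (e (S (y k))) := fun k =>
    (mixedData_solves_iff hσ hG M₁ M₂ hg hC _ _).2 (hsolve k)
  have hDupdate : ∀ k i, y (k + 1) i = max (y k i - ρ * D.x (e (S (y k))) i) 0 := fun k i => by
    rw [mixedData_x]
  refine ⟨fun k => S (y k), y, ⟨rfl, hsolve, fun _ _ => rfl⟩, fun u' y' h' => ?_, ?_,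
    fun us ys hsol => ?_⟩
  · have hu' : ∀ k, u' k = S (y' k) := fun k => (hS _ _).1 (h'.solve k)
    have hy' : ∀ k, y' k = y k := fun k => by
      induction k with
      | zero => exact h'.start
      | succ k ih =>
        ext i
        rw [h'.update k i, hu' k, ih]
    exact ⟨funext fun k => by rw [hu' k, hy' k], funext hy'⟩
  · obtain ⟨us, ys, hsol, hlim, hlim'⟩ := D.exists_tendsto hρ hρC rfl hDsolve hDupdate
    -- The abstract limit lives in the image in `L²`; it is pulled back to an actual discrete
    -- displacement.
    obtain ⟨us, rfl⟩ := e.surjective us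
    refine ⟨us, ys, (mixedData_isSolution_iff hσ hG M₁ M₂ hg hC ys us).1 hsol, ?_, ?_⟩
    · simpa only [e, norm_dispEquiv_sub] using hlim
    · simp only [normS_pwConst_sub hσ hG M₁ M₂ hg hC]
      simpa using hlim'.sqrt
  · have hsol' := (mixedData_isSolution_iff hσ hG M₁ M₂ hg hC ys ⟨us, hsol.equation.1⟩).2 hsol
    obtain ⟨hanti, hlim⟩ := hsol'.antitone_and_tendsto hρ hρC hDsolve hDupdate
    refine ⟨?_, ?_⟩
    · simp only [normS_pwConst_sub hσ hG M₁ M₂ hg hC]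
      exact fun i j hij => Real.sqrt_le_sqrt (hanti hij)
    · simpa only [e, norm_dispEquiv_sub] using hlim
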